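/- **Theorem.** Fix an integer $d\ge 2$, let $c_1,\dots,c_{2d-2}$ be distinct points of $\mathbb C$, and let $A_1,\dots,A_{2d-2}$ be complex numbers. For $i=1,\dots,2d-2$ and integers $m\ge 0$ set $$L_i=3A_i^2-4\sum_{j\ne i}\frac{A_j(c_i-c_j)+1}{(c_i-c_j)^2},\qquad E_{m+1}=\sum_{i=1}^{2d-2}\bigl(m\,c_i^{m-1}+c_i^mA_i\bigr)$$ (the term $m\,c_i^{m-1}$ is $0$ for $m=0$). For a non-constant rational map $f$, let $S_f$ be its Schwarzian derivative, i.e. the meromorphic function on $\mathbb C$ given by $S_f=\frac{f'''}{f'}-\frac32\left(\frac{f''}{f'}\right)^2$ where $f\neq\infty$, and by the limit of this expression at the poles of $f$. Then the following four problems have the same solutions $(A_1,\dots,A_{2d-2})$: 1. there is a rational map $f$ of degree $d$ such that $\displaystyle S_f(z)=-\frac32\sum_{i=1}^{2d-2}\frac{A_i(z-c_i)+1}{(z-c_i)^2}$ as meromorphic functions; 2. $L_i=0$ for $i=1,\dots,2d-2$ and $E_1=E_2=E_3=0$; 3. $L_i=0$ for $i=1,\dots,2d-3$ and $E_1=E_2=E_3=0$;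 4. $L_i=0$ for $i=1,\dots,2d-2$ and $E_1=E_2=0$. Moreover, every rational map $f$ as in 1 has a simple critical point (local degree $2$) at each $c_i$, $i=1,\dots,2d-2$, and $\infty$ is not a critical point of $f$. -/

import Mathlib

open Filter Topology Polynomial

noncomputable section

namespace RationalSchwarzian

/-- The value of the rational map `f` at a point `z` of `ℂ` where `f(z) ≠ ∞`, that is, where the
denominator of `f` in lowest terms does not vanish. -/
def value (f : RatFunc ℂ) (z : ℂ) : ℂ := f.eval (RingHom.id ℂ) z

/-- The degree of a rational map, written in lowest terms as `P / Q`: `max (deg P) (deg Q)`. -/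
def degree (f : RatFunc ℂ) : ℕ := max f.num.natDegree f.denom.natDegree

/-- The expression `g''' / g' - (3/2) (g'' / g')²`. -/
def schwarzianExpr (g : ℂ → ℂ) (z : ℂ) : ℂ :=
  iteratedDeriv 3 g z / deriv g z - 3 / 2 * (iteratedDeriv 2 g z / deriv g z) ^ 2

open Classical in
/-- The Schwarzian derivative `S_f` of a rational map `f`: it is given by the expression
`f''' / f' - (3/2) (f'' / f')²` at the points `z` of `ℂ` with `f(z) ≠ ∞`, and by the limit of this
expression at the poles of `f`. The function `S_f` is meromorphic, with poles at the critical
points of `f`; its values at these points carry no meaning. -/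
def schwarzian (f : RatFunc ℂ) (z : ℂ) : ℂ :=
  if f.denom.eval z ≠ 0 then schwarzianExpr (value f) z
  else limUnder (𝓝[≠] z) (schwarzianExpr (value f))

/-- The local degree at `z` of the map `P / Q`, where `P` and `Q` are polynomials without common
zero at `z`: the order of vanishing at `z` of `Q(z) P - P(z) Q`. If `Q(z) ≠ 0`, this is the order
of vanishing at `z` of `P / Q - P(z) / Q(z)`; if `Q(z) = 0`, it is the order of the pole `z`. -/
def quotientLocalDegree (P Q : ℂ[X]) (z : ℂ) : ℕ :=
  (C (Q.eval z) * P - C (P.eval z) * Q).rootMultiplicity z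

/-- The local degree of a non-constant rational map at a point of the Riemann sphere. At `∞`, it
is the local degree at `0` of `w ↦ f (1 / w) = (w ^ d P (1 / w)) / (w ^ d Q (1 / w))`, where
`f = P / Q` in lowest terms and `d` is the degree of `f`. -/
def localDegree (f : RatFunc ℂ) : OnePoint ℂ → ℕ
  | some z => quotientLocalDegree f.num f.denom z
  | none => quotientLocalDegree (f.num.reflect (degree f)) (f.denom.reflect (degree f)) 0

/-- `p` is a simple critical point of `f`: the local degree there is two. -/
def IsSimpleCriticalPoint (f : RatFunc ℂ) (p : OnePoint ℂ) : Prop := localDegree f p = 2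

/-- `p` is a regular (that is, not critical) point of `f`: the local degree there is one. -/
def IsRegularPoint (f : RatFunc ℂ) (p : OnePoint ℂ) : Prop := localDegree f p = 1

/-- `φ(z) = -(3/2) ∑ i, (A_i (z - c_i) + 1) / (z - c_i)²`. -/
def phi {n : ℕ} (c A : Fin n → ℂ) (z : ℂ) : ℂ :=
  -(3 / 2) * ∑ i, (A i * (z - c i) + 1) / (z - c i) ^ 2

/-- `L_i = 3 A_i² - 4 ∑ j ≠ i, (A_j (c_i - c_j) + 1) / (c_i - c_j)²`. -/
def L {n : ℕ} (c A : Fin n → ℂ) (i : Fin n) : ℂ :=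
  3 * A i ^ 2 - 4 * ∑ j ∈ Finset.univ.erase i, (A j * (c i - c j) + 1) / (c i - c j) ^ 2

/-- `E c A m` is `E_{m+1} = ∑ i, (m c_i ^ (m - 1) + c_i ^ m A_i)`; the first term is `0` if
`m = 0`. -/
def E {n : ℕ} (c A : Fin n → ℂ) (m : ℕ) : ℂ :=
  ∑ i, ((m : ℂ) * c i ^ (m - 1) + c i ^ m * A i)

/-- The rational map `f` has degree `d` and `S_f = φ`, as meromorphic functions: the two functions
agree at all points of `ℂ` other than the poles `c_i` of `φ`. -/
def IsSchwarzianPrimitive {n : ℕ} (c A : Fin n → ℂ) (d : ℕ) (f : RatFunc ℂ) : Prop :=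
  degree f = d ∧ ∀ z : ℂ, (∀ i, z ≠ c i) → schwarzian f z = phi c A z

end RationalSchwarzian

end

/-! Put `ω = nodePoly c`, `d = e + 2`, `n = 2e + 2`. If `f = P / Q` has Wronskian `W = P'Q - PQ'`,
then `S_f = φ` is a second order linear equation satisfied by both `P` and `Q`. Local analysis
forces `W = aω`, and the equation becomes `2ωy'' - 2ω'y' + Ty = 0`, with `T` determined by `φ`. Its
exponents are 0 and 2 at each node, and `L_i = 0` says that no logarithm occurs at `c i`. `E_1 = E_2
= 0` makes `e + 1` and `e + 2` the possible degrees of polynomial solutions, and `E_3 = 0` then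
excludes a logarithm at infinity. So problem 1 amounts to two independent polynomial solutions.

That one of the `2e + 3` local conditions is redundant reflects the monodromy relation: the last
local monodromy is trivial if all others are. The proof replaces monodromy by algebra. Pairs `(p,
q)` modelled on `(y, y')`, with bounded degrees and linear conditions at the nodes and at infinity,
form a space of dimension at least 2 (`exists_solutions`). The connection sends such a pair to one
of smaller degree, which vanishes by `Compatible.eq_zero`: otherwise its second fundamental form
would have more zeros than its degree allows, and it would span an invariant line of impossible
degree. Hence `q = p'` and `p` is a solution (`Compatible.isSolution`).

Conversely, `IsSchwarzianPrimitive.isSolution` recovers `W = aω` and the equation from `f`. Simple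
criticality at the nodes and regularity at infinity are read off from the zeros and the degree of
`W`. -/

namespace RationalSchwarzian

/-! ### The two leading coefficients of a polynomial -/

/-- `p = x X ^ (k + 1) + y X ^ k + ` terms of lower degree. -/
structure HasTop (p : ℂ[X]) (k : ℕ) (x y : ℂ) : Prop where
  natDegree_le : p.natDegree ≤ k + 1
  coeff_succ : p.coeff (k + 1) = x
  coeff_eq : p.coeff k = y

namespace HasTop

variable {p q : ℂ[X]} {k l : ℕ} {x y u v : ℂ}

theorem of_natDegree_le (h : p.natDegree ≤ k + 1) : HasTop p k (p.coeff (k + 1)) (p.coeff k) :=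
  ⟨h, rfl, rfl⟩

theorem add (hp : HasTop p k x y) (hq : HasTop q k u v) : HasTop (p + q) k (x + u) (y + v) :=
  ⟨natDegree_add_le_of_degree_le hp.1 hq.1, by rw [coeff_add, hp.2, hq.2],
    by rw [coeff_add, hp.3, hq.3]⟩

theorem const_mul (a : ℂ) (hp : HasTop p k x y) : HasTop (C a * p) k (a * x) (a * y) :=
  ⟨(natDegree_C_mul_le _ _).trans hp.1, by rw [coeff_C_mul, hp.2], by rw [coeff_C_mul, hp.3]⟩

theorem sub (hp : HasTop p k x y) (hq : HasTop q k u v) : HasTop (p - q) k (x - u) (y - v) :=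
  ⟨(natDegree_sub_le_of_le hp.1 hq.1).trans (max_self _).le, by rw [coeff_sub, hp.2, hq.2],
    by rw [coeff_sub, hp.3, hq.3]⟩

theorem mul (hp : HasTop p k x y) (hq : HasTop q l u v) :
    HasTop (p * q) (k + l + 1) (x * u) (x * v + y * u) := by
  refine ⟨(natDegree_mul_le_of_le hp.1 hq.1).trans (by omega), ?_, ?_⟩
  · rw [show k + l + 1 + 1 = (k + 1) + (l + 1) by ring,
      coeff_mul_add_eq_of_natDegree_le hp.1 hq.1, hp.2, hq.2]
  · rw [coeff_mul, Finset.sum_eq_add_of_mem (k + 1, l) (k, l + 1)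
      (by simp; ring) (by simp; ring) (by simp)]
    · simp only [hp.2, hq.2, hp.3, hq.3]
    · rintro ⟨i, j⟩ hij ⟨h1, h2⟩
      rw [Finset.HasAntidiagonal.mem_antidiagonal] at hij
      simp only [ne_eq, Prod.mk.injEq, not_and] at hij h1 h2
      rcases lt_or_ge (k + 1) i with hi | hi
      · simp [coeff_eq_zero_of_natDegree_lt (hp.1.trans_lt hi)]
      · have hj : l + 1 < j := by
          by_contra hj
          have : i = k + 1 ∨ i = k := by omega
          rcases this with rfl | rfl
          · exact h1 rfl (by omega)
          · exact h2 rfl (by omega)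
        simp [coeff_eq_zero_of_natDegree_lt (hq.1.trans_lt hj)]

/-- The Euler operator is diagonal on monomials, so it keeps the two-coefficient window in place;
differential equations are multiplied by `X ^ 2` below for this reason. -/
theorem X_mul_derivative (hp : HasTop p k x y) :
    HasTop (X * derivative p) k ((k + 1 : ℂ) * x) (k * y) := by
  have hc : ∀ i, (X * derivative p).coeff i = i * p.coeff i := by
    rintro (_ | i)
    · simp
    · rw [coeff_X_mul, coeff_derivative]; push_cast; ring
  refine ⟨?_, ?_, ?_⟩
  · rw [natDegree_le_iff_coeff_eq_zero]
    intro i hi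
    rw [hc, coeff_eq_zero_of_natDegree_lt (hp.1.trans_lt hi), mul_zero]
  · rw [hc, hp.2]; push_cast; ring
  · rw [hc, hp.3]

theorem X_sq_mul_derivative_derivative (hp : HasTop p k x y) :
    HasTop (X ^ 2 * derivative (derivative p)) k ((k + 1 : ℂ) * k * x) (k * (k - 1) * y) := by
  have h : X ^ 2 * derivative (derivative p)
      = X * derivative (X * derivative p) - X * derivative p := by
    simp only [derivative_mul, derivative_X]; ring
  have := hp.X_mul_derivative.X_mul_derivative.sub hp.X_mul_derivative
  rw [← h] at this
  convert this using 1 <;> ring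

theorem unique (hp : HasTop p k x y) (hq : HasTop p k u v) : x = u ∧ y = v :=
  ⟨hp.2.symm.trans hq.2, hp.3.symm.trans hq.3⟩

end HasTop

theorem natDegree_le_of_monic_mul {p q : ℂ[X]} {a b : ℕ} (hp : p.Monic) (ha : p.natDegree = a)
    (h : (p * q).natDegree ≤ a + b) : q.natDegree ≤ b := by
  by_cases hq : q = 0
  · simp [hq]
  · rw [hp.natDegree_mul' hq, ha] at h; omega

/-- Bounding `X * p` by `a` encodes `deg p < a` without truncated subtraction; for `a = 0` it forces
`p = 0`. -/
theorem natDegree_X_mul_le {p : ℂ[X]} {a : ℕ} (h : (X * p).natDegree ≤ a) :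
    p = 0 ∨ p.natDegree + 1 ≤ a := by
  by_cases hp : p = 0
  · exact Or.inl hp
  · rw [natDegree_X_mul hp] at h; exact Or.inr h

/-! ### The polynomial with simple zeros at the nodes -/

variable {n : ℕ} (c A : Fin n → ℂ)

/-- The monic polynomial with simple zeros at the points `c i`. -/
noncomputable def nodePoly : ℂ[X] := ∏ i, (X - C (c i))

/-- The product of the factors of `nodePoly c` other than the one of index `i`. -/
noncomputable def cofactor (i : Fin n) : ℂ[X] := ∏ j ∈ Finset.univ.erase i, (X - C (c j))

/-- The polynomial `φ ω²`, where `ω = nodePoly c`. -/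
noncomputable def phiNum : ℂ[X] :=
  C (-(3 / 2)) * ∑ i, (C (A i) * (X - C (c i)) + 1) * cofactor c i ^ 2

theorem nodePoly_eq (i : Fin n) : nodePoly c = (X - C (c i)) * cofactor c i :=
  (Finset.mul_prod_erase _ _ (Finset.mem_univ i)).symm

theorem nodePoly_monic : (nodePoly c).Monic := monic_prod_of_monic _ _ fun _ _ => monic_X_sub_C _

theorem natDegree_nodePoly : (nodePoly c).natDegree = n := by
  rw [nodePoly, natDegree_prod_of_monic _ _ fun _ _ => monic_X_sub_C _]
  simp

theorem natDegree_cofactor (i : Fin n) : (cofactor c i).natDegree = n - 1 := by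
  rw [cofactor, natDegree_prod_of_monic _ _ fun _ _ => monic_X_sub_C _]
  simp

theorem eval_nodePoly_eq_zero {z : ℂ} : (nodePoly c).eval z = 0 ↔ ∃ i, z = c i := by
  simp [nodePoly, eval_prod, Finset.prod_eq_zero_iff, sub_eq_zero]

@[simp] theorem eval_nodePoly_node (i : Fin n) : (nodePoly c).eval (c i) = 0 :=
  (eval_nodePoly_eq_zero c).2 ⟨i, rfl⟩

theorem eval_derivative_nodePoly (i : Fin n) :
    (derivative (nodePoly c)).eval (c i) = (cofactor c i).eval (c i) := by
  rw [nodePoly_eq c i]; simp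

variable {c}

theorem eval_cofactor_ne_zero (hc : Function.Injective c) (i : Fin n) :
    (cofactor c i).eval (c i) ≠ 0 := by
  rw [cofactor, eval_prod, Finset.prod_ne_zero_iff]
  intro j hj
  simpa [sub_eq_zero] using fun h => (Finset.ne_of_mem_erase hj) (hc h).symm

theorem eval_derivative_nodePoly_ne_zero (hc : Function.Injective c) (i : Fin n) :
    (derivative (nodePoly c)).eval (c i) ≠ 0 := by
  rw [eval_derivative_nodePoly]; exact eval_cofactor_ne_zero hc i

theorem nodePoly_dvd (hc : Function.Injective c) {p : ℂ[X]} (h : ∀ i, p.eval (c i) = 0) :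
    nodePoly c ∣ p :=
  Fintype.prod_dvd_of_coprime (pairwise_coprime_X_sub_C hc)
    fun i => dvd_iff_isRoot.2 (h i)

theorem eq_zero_of_eval_eq_zero_of_ne (hc : Function.Injective c) {p : ℂ[X]} (i₀ : Fin n)
    (h : ∀ i, i ≠ i₀ → p.eval (c i) = 0) (hp : p.natDegree + 1 < n) : p = 0 := by
  classical
  refine eq_zero_of_natDegree_lt_card_of_eval_eq_zero' p ((Finset.univ.erase i₀).image c) ?_ ?_
  · intro z hz
    obtain ⟨i, hi, rfl⟩ := Finset.mem_image.1 hz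
    exact h i (Finset.ne_of_mem_erase hi)
  · rw [Finset.card_image_of_injective _ hc, Finset.card_erase_of_mem (Finset.mem_univ _)]
    simp; omega

theorem eval_phiNum (z : ℂ) (hz : ∀ i, z ≠ c i) :
    (phiNum c A).eval z = phi c A z * (nodePoly c).eval z ^ 2 := by
  simp only [phiNum, phi, eval_mul, eval_C, eval_finsetSum, eval_add, eval_sub, eval_X, eval_one,
    eval_pow]
  rw [mul_assoc, Finset.sum_mul]
  congr 1
  refine Finset.sum_congr rfl fun i _ => ?_
  have : z - c i ≠ 0 := sub_ne_zero.2 (hz i)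
  rw [nodePoly_eq c i]
  simp only [eval_mul, eval_sub, eval_X, eval_C]
  field_simp

/-- Every cofactor other than the one of index `i` vanishes at `c i`, so the remaining terms contain
`(X - c i)²`; the value of `G` is the sum in `L_i`. -/
theorem phiNum_eq (i : Fin n) : ∃ G : ℂ[X],
    phiNum c A = C (-(3 / 2)) * cofactor c i ^ 2 * (C (A i) * (X - C (c i)) + 1)
        + (X - C (c i)) ^ 2 * G ∧
      (Function.Injective c → G.eval (c i) = -(3 / 2) * (cofactor c i).eval (c i) ^ 2 *
        ∑ j ∈ Finset.univ.erase i, (A j * (c i - c j) + 1) / (c i - c j) ^ 2) := by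
  set χ : Fin n → ℂ[X] := fun j => ∏ k ∈ (Finset.univ.erase i).erase j, (X - C (c k)) with hχ
  have h1 : ∀ j ∈ Finset.univ.erase i, cofactor c j = (X - C (c i)) * χ j := by
    intro j hj
    rw [hχ, cofactor]
    simp only
    rw [Finset.erase_right_comm, Finset.mul_prod_erase (f := fun k => X - C (c k))]
    exact Finset.mem_erase.2 ⟨(Finset.ne_of_mem_erase hj).symm, Finset.mem_univ i⟩
  have h2 : ∀ j ∈ Finset.univ.erase i, cofactor c i = (X - C (c j)) * χ j := by
    intro j hj
    rw [hχ, cofactor]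
    exact (Finset.mul_prod_erase (f := fun k => X - C (c k)) _ hj).symm
  refine ⟨C (-(3 / 2)) * ∑ j ∈ Finset.univ.erase i,
    (C (A j) * (X - C (c j)) + 1) * χ j ^ 2, ?_, ?_⟩
  · have h3 : ∑ j ∈ Finset.univ.erase i, (C (A j) * (X - C (c j)) + 1) * cofactor c j ^ 2
        = (X - C (c i)) ^ 2 * ∑ j ∈ Finset.univ.erase i,
          (C (A j) * (X - C (c j)) + 1) * χ j ^ 2 := by
      rw [Finset.mul_sum]
      exact Finset.sum_congr rfl fun j hj => by rw [h1 j hj]; ring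
    rw [phiNum, ← Finset.add_sum_erase _ _ (Finset.mem_univ i), h3]
    ring
  · intro hc
    rw [eval_mul, eval_C, mul_assoc, eval_finsetSum]
    refine congrArg _ ?_
    rw [Finset.mul_sum]
    refine Finset.sum_congr rfl fun j hj => ?_
    have hij : c i - c j ≠ 0 := sub_ne_zero.2 fun h => Finset.ne_of_mem_erase hj (hc h).symm
    rw [h2 j hj]
    simp only [eval_mul, eval_sub, eval_add, eval_X, eval_C, eval_one, eval_pow]
    field_simp

/-! ### The accessory polynomial and the absence of logarithms -/

variable {A} {T : ℂ[X]}

/-- The relation between the coefficient `T` of the differential equation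
`2 ω y'' - 2 ω' y' + T y = 0`, where `ω = nodePoly c`, and the potential `φ`. -/
def IsAccessory (c A : Fin n → ℂ) (T : ℂ[X]) : Prop :=
  nodePoly c * T = phiNum c A - nodePoly c * derivative (derivative (nodePoly c))
    + C (3 / 2) * derivative (nodePoly c) ^ 2

/-- At a node the double pole of `φ`, with coefficient `-3/2`, cancels `(3/2) ω'²`, whence
divisibility by `ω`. -/
theorem exists_isAccessory (hc : Function.Injective c) (A : Fin n → ℂ) :
    ∃ T, IsAccessory c A T := by
  obtain ⟨T, hT⟩ := nodePoly_dvd hc (p := phiNum c A -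
    nodePoly c * derivative (derivative (nodePoly c)) + C (3 / 2) * derivative (nodePoly c) ^ 2)
    (fun i => by
      obtain ⟨G, hG, -⟩ := phiNum_eq A (c := c) i
      rw [hG]
      simp [eval_derivative_nodePoly])
  exact ⟨T, hT.symm⟩

/-- The condition that the differential equation `2 ω y'' - 2 ω' y' + T y = 0` has no logarithmic
solution at the node of index `i`. -/
def NoLog (c : Fin n → ℂ) (T : ℂ[X]) (i : Fin n) : Prop :=
  2 * (derivative (nodePoly c)).eval (c i) * (derivative T).eval (c i) + T.eval (c i) ^ 2
    - 2 * (derivative (derivative (nodePoly c))).eval (c i) * T.eval (c i) = 0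

/-- Expanding the relation for `T` to first order at `c i` gives `T(c i)` and `T'(c i)`; the `NoLog`
expression is then `(3/4) ψ(c i)² L_i`, with `ψ` the cofactor. -/
theorem noLog_iff (hc : Function.Injective c) (hT : IsAccessory c A T) (i : Fin n) :
    NoLog c T i ↔ L c A i = 0 := by
  obtain ⟨G, hG, hGe⟩ := phiNum_eq A (c := c) i
  have hψ := eval_cofactor_ne_zero hc i
  have hGe := hGe hc
  rw [L]
  set S := ∑ j ∈ Finset.univ.erase i, (A j * (c i - c j) + 1) / (c i - c j) ^ 2
  set ψ := cofactor c i
  have key : ψ * T = C (-(3 / 2)) * C (A i) * ψ ^ 2 + (X - C (c i)) * G + ψ * derivative ψ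
      + C (3 / 2) * (X - C (c i)) * derivative ψ ^ 2
      - (X - C (c i)) * ψ * derivative (derivative ψ) := by
    apply mul_left_cancel₀ (X_sub_C_ne_zero (c i))
    have h := hT
    rw [IsAccessory, hG, nodePoly_eq c i] at h
    simp only [derivative_mul, derivative_sub, derivative_X, derivative_C, derivative_add,
      derivative_zero, derivative_one] at h
    have h3 : C (-(3 / 2) : ℂ) = -C (3 / 2) := C_neg
    have h4 : (C (3 / 2 : ℂ)) * 2 = 3 := by
      rw [show (2 : ℂ[X]) = C 2 from rfl, ← C_mul]; norm_num; rfl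
    rw [h3] at h ⊢
    linear_combination h + (X - C (c i)) * ψ * derivative ψ * h4
  have h0 := congrArg (eval (c i)) key
  have h1 := congrArg (fun p => eval (c i) (derivative p)) key
  simp only [derivative_mul, derivative_sub, derivative_X, derivative_C, derivative_add,
    derivative_pow, eval_add, eval_sub, eval_mul, eval_X, eval_C, eval_pow, sub_self,
    zero_mul, mul_zero, add_zero, zero_add, sub_zero, one_mul, mul_one,
    hGe] at h0 h1
  norm_num at h0 h1
  have e0 : T.eval (c i) = -(3 / 2) * A i * ψ.eval (c i) + (derivative ψ).eval (c i) := by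
    apply mul_left_cancel₀ hψ
    linear_combination h0
  have e1 : (derivative (nodePoly c)).eval (c i) = ψ.eval (c i) := eval_derivative_nodePoly c i
  have e2 : (derivative (derivative (nodePoly c))).eval (c i) = 2 * (derivative ψ).eval (c i) := by
    rw [nodePoly_eq c i]
    simp [derivative_mul]
    ring
  have e3 : 2 * (derivative (nodePoly c)).eval (c i) * (derivative T).eval (c i)
      + T.eval (c i) ^ 2 - 2 * (derivative (derivative (nodePoly c))).eval (c i) * T.eval (c i)
      = 3 / 4 * ψ.eval (c i) ^ 2 * (3 * A i ^ 2 - 4 * S) := by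
    rw [e1, e2]
    rw [e0] at h1 ⊢
    linear_combination 2 * h1
  rw [NoLog, e3]
  simp [hψ]

variable {e : ℕ}

/-! ### The behaviour at infinity -/

/-- This is the expansion at infinity `φ = -(3/2)(E_1/z + E_2/z² + E_3/z³ + O(z⁻⁴))`, multiplied by
`z³ω²`. -/
theorem X_pow_mul_phiNum (hn : n = 2 * e + 2) (c A : Fin n → ℂ) : ∃ R : ℂ[X],
    R.natDegree ≤ 4 * e + 3 ∧ X ^ 3 * phiNum c A = C (-(3 / 2)) * (nodePoly c ^ 2 *
      (C (E c A 0) * X ^ 2 + C (E c A 1) * X + C (E c A 2)) + R) := by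
  refine ⟨∑ i, (C (3 * c i ^ 2 + c i ^ 3 * A i) * X - C (c i ^ 2 * (2 * c i + c i ^ 2 * A i)))
    * cofactor c i ^ 2, ?_, ?_⟩
  · refine natDegree_sum_le_of_forall_le _ _ fun i _ => ?_
    refine (natDegree_mul_le_of_le (m := 1) (n := 2 * (2 * e + 1)) (by compute_degree) ?_).trans
      (by omega)
    refine (natDegree_pow_le_of_le 2 (natDegree_cofactor c i).le).trans (by omega)
  · have h : ∀ i, X ^ 3 * ((C (A i) * (X - C (c i)) + 1) * cofactor c i ^ 2)
        = nodePoly c ^ 2 * (C (A i) * X ^ 2 + C (1 + c i * A i) * X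
          + C (2 * c i + c i ^ 2 * A i))
        + (C (3 * c i ^ 2 + c i ^ 3 * A i) * X - C (c i ^ 2 * (2 * c i + c i ^ 2 * A i)))
          * cofactor c i ^ 2 := by
      intro i
      rw [nodePoly_eq c i]
      simp only [C_add, C_mul, C_pow, C_1, map_ofNat]
      ring
    rw [phiNum, mul_left_comm, Finset.mul_sum, Finset.sum_congr rfl fun i _ => h i,
      Finset.sum_add_distrib, ← Finset.mul_sum]
    congr 3
    simp [E, Finset.sum_add_distrib, map_sum, Finset.sum_mul, add_mul]

theorem natDegree_nodePoly_sq_mul_le (hn : n = 2 * e + 2) {p : ℂ[X]} {b : ℕ}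
    (h : p.natDegree ≤ b) : (nodePoly c ^ 2 * p).natDegree ≤ 4 * e + 4 + b := by
  refine natDegree_mul_le_of_le ?_ h
  rw [(nodePoly_monic c).natDegree_pow, natDegree_nodePoly]
  omega

theorem natDegree_phiNum_le (hn : n = 2 * e + 2) (h0 : E c A 0 = 0) (h1 : E c A 1 = 0) :
    (phiNum c A).natDegree ≤ 4 * e + 1 := by
  obtain ⟨R, hR, h⟩ := X_pow_mul_phiNum hn c A
  have h2 : (X ^ 3 * phiNum c A).natDegree ≤ 3 + (4 * e + 1) := by
    rw [h, h0, h1]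
    refine (natDegree_C_mul_le _ _).trans (natDegree_add_le_of_degree_le ?_ (by omega))
    refine (natDegree_nodePoly_sq_mul_le hn (b := 0) (by simp)).trans (by omega)
  exact natDegree_le_of_monic_mul (monic_X_pow 3) (natDegree_X_pow 3) h2

theorem coeff_phiNum_eq_zero (hn : n = 2 * e + 2) (h0 : E c A 0 = 0) (h1 : E c A 1 = 0)
    (h2 : E c A 2 = 0) : (phiNum c A).coeff (4 * e + 1) = 0 := by
  obtain ⟨R, hR, h⟩ := X_pow_mul_phiNum hn c A
  rw [← coeff_X_pow_mul _ 3, h, h0, h1, h2]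
  simp [coeff_eq_zero_of_natDegree_lt (show R.natDegree < 4 * e + 1 + 3 by omega)]

theorem E_eq_zero (hn : n = 2 * e + 2) (h : (X ^ 3 * phiNum c A).natDegree ≤ 4 * e + 3) :
    E c A 0 = 0 ∧ E c A 1 = 0 ∧ E c A 2 = 0 := by
  obtain ⟨R, hR, h'⟩ := X_pow_mul_phiNum hn c A
  rw [h', natDegree_C_mul (by norm_num)] at h
  set p := C (E c A 0) * X ^ 2 + C (E c A 1) * X + C (E c A 2) with hp
  have h1 : (nodePoly c ^ 2 * p).natDegree ≤ 4 * e + 3 := by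
    have := natDegree_sub_le_of_le h hR
    rwa [add_sub_cancel_right, max_self] at this
  have h2 : p = 0 := by
    by_contra h2
    rw [((nodePoly_monic c).pow 2).natDegree_mul' h2, (nodePoly_monic c).natDegree_pow,
      natDegree_nodePoly] at h1
    omega
  rw [hp] at h2
  refine ⟨?_, ?_, ?_⟩
  · simpa [coeff_X, coeff_C] using congrArg (coeff · 2) h2
  · simpa [coeff_X, coeff_C] using congrArg (coeff · 1) h2
  · simpa [coeff_X, coeff_C] using congrArg (coeff · 0) h2

theorem hasTop_nodePoly (hn : n = 2 * e + 2) :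
    HasTop (nodePoly c) (2 * e + 1) 1 ((nodePoly c).coeff (2 * e + 1)) := by
  have hd : (nodePoly c).natDegree = 2 * e + 2 := by rw [natDegree_nodePoly, hn]
  refine ⟨hd.le, ?_, rfl⟩
  have := (nodePoly_monic c).coeff_natDegree
  rwa [hd] at this

theorem X_sq_mul_phiNum (hT : IsAccessory c A T) :
    X ^ 2 * phiNum c A = nodePoly c * (X ^ 2 * T)
      + nodePoly c * (X ^ 2 * derivative (derivative (nodePoly c)))
      - C (3 / 2) * ((X * derivative (nodePoly c)) * (X * derivative (nodePoly c))) := by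
  rw [IsAccessory] at hT
  linear_combination (-X ^ 2) * hT

/-- The leading coefficients of `X ^ 2 * T` in terms of those of `φ ω²`. -/
theorem hasTop_accessory (hn : n = 2 * e + 2) (hT : IsAccessory c A T)
    (hΦ : (phiNum c A).natDegree ≤ 4 * e + 1) :
    HasTop (X ^ 2 * T) (2 * e + 1) (2 * (e + 2) * (e + 1))
      (2 * (e + 2) * e * (nodePoly c).coeff (2 * e + 1) + (phiNum c A).coeff (4 * e + 1)) := by
  have hω := hasTop_nodePoly (c := c) hn
  have hΦ' : HasTop (X ^ 2 * phiNum c A) (2 * e + 1 + (2 * e + 1) + 1)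
      0 ((phiNum c A).coeff (4 * e + 1)) := by
    refine ⟨(natDegree_mul_le_of_le (natDegree_X_pow 2).le hΦ).trans (by omega), ?_, ?_⟩
    · rw [show 2 * e + 1 + (2 * e + 1) + 1 + 1 = 4 * e + 2 + 2 by ring, coeff_X_pow_mul,
        coeff_eq_zero_of_natDegree_lt (by omega)]
    · rw [show 2 * e + 1 + (2 * e + 1) + 1 = 4 * e + 1 + 2 by ring, coeff_X_pow_mul]
  have key := X_sq_mul_phiNum hT
  have h1 := (hΦ'.sub (hω.mul hω.X_sq_mul_derivative_derivative)).add
    ((hω.X_mul_derivative.mul hω.X_mul_derivative).const_mul (3 / 2))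
  rw [key, add_sub_assoc, add_sub_assoc, add_assoc] at h1
  rw [show ∀ a b c : ℂ[X], a + (b - c - b + c) = a by intros; ring] at h1
  have hdeg : (X ^ 2 * T).natDegree ≤ 2 * e + 1 + 1 := by
    refine natDegree_le_of_monic_mul (nodePoly_monic c) (natDegree_nodePoly c) (h1.1.trans ?_)
    omega
  have h2 := HasTop.of_natDegree_le hdeg
  obtain ⟨h3, h4⟩ := (hω.mul h2).unique h1
  have h3' : (X ^ 2 * T).coeff (2 * e + 1 + 1) = (2 * (e + 2) * (e + 1) : ℂ) := by
    rw [one_mul] at h3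
    rw [h3]; push_cast; ring
  refine ⟨hdeg, h3', ?_⟩
  rw [h3'] at h4
  push_cast at h4
  linear_combination h4

theorem E_eq_zero_of_hasTop (hn : n = 2 * e + 2) (hT : IsAccessory c A T)
    (h : HasTop (X ^ 2 * T) (2 * e + 1) (2 * (e + 2) * (e + 1))
      (2 * (e + 2) * e * (nodePoly c).coeff (2 * e + 1))) :
    E c A 0 = 0 ∧ E c A 1 = 0 ∧ E c A 2 = 0 := by
  have hω := hasTop_nodePoly (c := c) hn
  have h1 := ((hω.mul h).add (hω.mul hω.X_sq_mul_derivative_derivative)).sub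
    ((hω.X_mul_derivative.mul hω.X_mul_derivative).const_mul (3 / 2))
  rw [← X_sq_mul_phiNum hT] at h1
  obtain ⟨h2, h3, h4⟩ := h1
  have h5 : (X ^ 2 * phiNum c A).natDegree ≤ 4 * e + 2 := by
    rw [natDegree_le_iff_coeff_eq_zero]
    intro i hi
    rcases (show i = 4 * e + 3 ∨ i = 4 * e + 4 ∨ 4 * e + 4 < i by omega) with rfl | rfl | hi
    · convert h4 using 2
      · ring
      · push_cast; ring
    · convert h3 using 2
      · ring
      · push_cast; ring
    · exact coeff_eq_zero_of_natDegree_lt (by omega)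
  apply E_eq_zero hn
  rw [pow_succ', mul_assoc]
  exact (natDegree_mul_le_of_le natDegree_X_le h5).trans (by omega)

/-! ### Pairs of polynomials compatible with the differential equation

A pair `(s, u)` is thought of as a section of a vector bundle of rank two with the connection
`(s, u) ↦ (s' - u, u' + (T s - 2 ω' u) / (2 ω))`. The horizontal sections are the pairs `(y, y')`,
where `y` is a solution of `2 ω y'' - 2 ω' y' + T y = 0`. -/

/-- The condition at the nodes under which the connection takes polynomial values on `(s, u)`. -/
def Compatible (c : Fin n → ℂ) (T s u : ℂ[X]) : Prop :=
  ∀ i, T.eval (c i) * s.eval (c i) = 2 * (derivative (nodePoly c)).eval (c i) * u.eval (c i)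

theorem Compatible.exists_eq (hc : Function.Injective c) {s u : ℂ[X]} (h : Compatible c T s u) :
    ∃ m, nodePoly c * (2 * m) = T * s - 2 * derivative (nodePoly c) * u := by
  obtain ⟨m, hm⟩ := nodePoly_dvd hc (p := T * s - 2 * derivative (nodePoly c) * u)
    (fun i => by simpa [sub_eq_zero] using h i)
  refine ⟨C (1 / 2) * m, ?_⟩
  have h2 : (2 : ℂ[X]) * C (1 / 2) = 1 := by
    rw [show (2 : ℂ[X]) = C 2 from rfl, ← C_mul]; norm_num
  rw [hm]
  linear_combination nodePoly c * m * h2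

theorem natDegree_accessory_le {x y : ℂ} (hT : HasTop (X ^ 2 * T) (2 * e + 1) x y) :
    T.natDegree ≤ 2 * e :=
  natDegree_le_of_monic_mul (monic_X_pow 2) (natDegree_X_pow 2) (hT.1.trans (by omega))

theorem eval_connection {s u m : ℂ[X]}
    (hm : nodePoly c * (2 * m) = T * s - 2 * derivative (nodePoly c) * u) (i : Fin n) :
    2 * (derivative (nodePoly c)).eval (c i) * (derivative u + m).eval (c i)
      = (derivative T).eval (c i) * s.eval (c i) + T.eval (c i) * (derivative s).eval (c i)
        - 2 * (derivative (derivative (nodePoly c))).eval (c i) * u.eval (c i) := by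
  have h := congrArg (fun p => eval (c i) (derivative p)) hm
  simp [derivative_mul] at h
  rw [eval_add]
  linear_combination h

/-- The terms `T s'` cancel, and the difference of the two sides is a multiple of `s(c i)` times the
`NoLog` expression. -/
theorem NoLog.compatible_connection (hc : Function.Injective c) {i : Fin n} (h : NoLog c T i)
    {s u m : ℂ[X]} (hs : Compatible c T s u)
    (hm : nodePoly c * (2 * m) = T * s - 2 * derivative (nodePoly c) * u) :
    T.eval (c i) * (derivative s - u).eval (c i)
      = 2 * (derivative (nodePoly c)).eval (c i) * (derivative u + m).eval (c i) := by
  have h1 := hs i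
  rw [eval_connection hm, eval_sub]
  apply mul_left_cancel₀ (eval_derivative_nodePoly_ne_zero hc i)
  rw [NoLog] at h
  linear_combination (-1 / 2) * s.eval (c i) * h
    + ((1 / 2) * T.eval (c i) - (derivative (derivative (nodePoly c))).eval (c i)) * h1

theorem exists_isCoprime_mul_eq {s u t v : ℂ[X]} (hs : s ≠ 0) (h : s * v = u * t) :
    ∃ k a, IsCoprime k a ∧ a ≠ 0 ∧ k * s = a * t ∧ k * u = a * v := by
  set g := EuclideanDomain.gcd t s
  obtain ⟨k, hk⟩ : g ∣ t := EuclideanDomain.gcd_dvd_left t s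
  obtain ⟨a, ha⟩ : g ∣ s := EuclideanDomain.gcd_dvd_right t s
  have hg : g ≠ 0 := by rintro hg; simp [hg] at ha; exact hs ha
  refine ⟨k, a, ?_, ?_, ?_, ?_⟩
  · refine ⟨EuclideanDomain.gcdA t s, EuclideanDomain.gcdB t s, ?_⟩
    apply mul_left_cancel₀ hg
    have := EuclideanDomain.gcd_eq_gcd_ab t s
    linear_combination -this - EuclideanDomain.gcdA t s * hk - EuclideanDomain.gcdB t s * ha
  · rintro rfl; simp at ha; exact hs ha
  · rw [ha, hk]; ring
  · apply mul_left_cancel₀ hg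
    linear_combination -u * hk + v * ha - h

/-- If the connection maps `(s, u)` to a polynomial multiple of itself, this multiple is zero. -/
theorem eq_zero_of_connection_eq_mul (hn : n = 2 * e + 2) (hT : T.natDegree ≤ 2 * e)
    {s u m k : ℂ[X]} (hs : s ≠ 0)
    (hm : nodePoly c * (2 * m) = T * s - 2 * derivative (nodePoly c) * u)
    (h1 : derivative s - u = k * s) (h2 : derivative u + m = k * u) : k = 0 := by
  by_contra hk
  -- If `deg u < deg s`, then `s' - u` has smaller degree than `s` and cannot be `k s` with `k ≠ 0`.
  -- The second component then bounds `deg ω + deg k + deg u` by `2e + 1 + deg u`.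
  have h3 : s.degree ≤ u.degree := by
    have h4 : s.degree ≤ (derivative s - u).degree := by
      rw [h1, degree_mul]
      exact le_add_of_nonneg_left (zero_le_degree_iff.2 hk)
    by_contra! h5
    exact (h4.trans (degree_sub_le _ _)).not_gt (max_lt (degree_derivative_lt hs) h5)
  have hu : u ≠ 0 := by
    rintro rfl
    rw [degree_zero, le_bot_iff, degree_eq_bot] at h3
    exact hs h3
  have h6 : nodePoly c * (2 * (k * u))
      = 2 * (nodePoly c * derivative u) + T * s - 2 * derivative (nodePoly c) * u := by
    linear_combination hm - 2 * nodePoly c * h2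
  have h7 : (nodePoly c * (2 * (k * u))).natDegree ≤ 2 * e + 1 + u.natDegree := by
    rw [h6]
    have h8 : (derivative (nodePoly c)).natDegree ≤ 2 * e + 1 :=
      (natDegree_derivative_le _).trans (by rw [natDegree_nodePoly]; omega)
    have h9 := natDegree_le_natDegree h3
    refine (natDegree_sub_le_of_le (natDegree_add_le_of_degree_le (n := 2 * e + 1 + u.natDegree)
      ?_ ?_) (n := 2 * e + 1 + u.natDegree) ?_).trans (max_self _).le
    · rw [show (2 : ℂ[X]) = C 2 from rfl]
      refine (natDegree_C_mul_le _ _).trans ?_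
      by_cases h10 : u.natDegree = 0
      · rw [natDegree_eq_zero.1 h10 |>.choose_spec.symm]; simp
      · refine (natDegree_mul_le_of_le (natDegree_nodePoly c).le
          (natDegree_derivative_le u)).trans (by omega)
    · exact (natDegree_mul_le_of_le hT h9).trans (by omega)
    · rw [show (2 : ℂ[X]) = C 2 from rfl]
      exact natDegree_mul_le_of_le ((natDegree_C_mul_le _ _).trans h8) le_rfl
  have h10 : 2 * (k * u) ≠ 0 := mul_ne_zero two_ne_zero (mul_ne_zero hk hu)
  rw [(nodePoly_monic c).natDegree_mul' h10, natDegree_nodePoly,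
    show (2 : ℂ[X]) = C 2 from rfl, natDegree_C_mul two_ne_zero, natDegree_mul hk hu] at h7
  omega

/-- The degree of a polynomial solution of `2 ω y'' - 2 ω' y' + T y = 0` is `e + 1` or `e + 2`. -/
theorem natDegree_solution (hn : n = 2 * e + 2) {y : ℂ}
    (hT : HasTop (X ^ 2 * T) (2 * e + 1) (2 * (e + 2) * (e + 1)) y) {s : ℂ[X]} (hs : s ≠ 0)
    (h : 2 * nodePoly c * derivative (derivative s) - 2 * derivative (nodePoly c) * derivative s
      + T * s = 0) : s.natDegree = e + 1 ∨ s.natDegree = e + 2 := by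
  have hω := hasTop_nodePoly (c := c) hn
  have he : (2 * (e + 2) * (e + 1) : ℂ) ≠ 0 := by norm_cast
  obtain hN | ⟨k, hk⟩ : s.natDegree = 0 ∨ ∃ k, s.natDegree = k + 1 := by
    rcases hd : s.natDegree with _ | k
    · exact Or.inl rfl
    · exact Or.inr ⟨k, rfl⟩
  · obtain ⟨a, rfl⟩ := natDegree_eq_zero.1 hN
    have hT0 : T = 0 := by simpa [hs] using h
    rw [hT0] at hT
    exact absurd (by simpa using hT.coeff_succ.symm) he
  · have hlc : s.coeff (k + 1) ≠ 0 := by rwa [← hk, coeff_natDegree, leadingCoeff_ne_zero]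
    have h1 := HasTop.of_natDegree_le hk.le
    have h2 := ((((hω.mul h1.X_sq_mul_derivative_derivative).const_mul 2).sub
      ((hω.X_mul_derivative.mul h1.X_mul_derivative).const_mul 2)).add (hT.mul h1)).coeff_succ
    have h3 : C 2 * (nodePoly c * (X ^ 2 * derivative (derivative s)))
        - C 2 * (X * derivative (nodePoly c) * (X * derivative s)) + X ^ 2 * T * s = 0 := by
      rw [show C (2 : ℂ) = 2 from rfl]
      linear_combination X ^ 2 * h
    rw [h3, coeff_zero] at h2
    push_cast at h2
    -- The indicial equation at infinity, for degree `k + 1`.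
    have h4 : ((k : ℂ) - e) * (k - (e + 1)) = 0 := by
      have h5 : (2 * s.coeff (k + 1)) * (((k : ℂ) - e) * (k - (e + 1))) = 0 := by
        linear_combination -h2
      simpa [hlc] using h5
    rcases mul_eq_zero.1 h4 with h5 | h5
    · left
      have : k = e := by exact_mod_cast sub_eq_zero.1 h5
      omega
    · right
      have : k = e + 1 := by exact_mod_cast sub_eq_zero.1 h5
      omega

theorem natDegree_X_mul_derivative_le (p : ℂ[X]) : (X * derivative p).natDegree ≤ p.natDegree := by
  rw [natDegree_le_iff_coeff_eq_zero]
  rintro (_ | i) hi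
  · simp
  · rw [coeff_X_mul, coeff_derivative, coeff_eq_zero_of_natDegree_lt hi, zero_mul]

theorem natDegree_X_mul_connection_le (hn : n = 2 * e + 2) (hT : T.natDegree ≤ 2 * e)
    {s u m : ℂ[X]} (hm : nodePoly c * (2 * m) = T * s - 2 * derivative (nodePoly c) * u) {b : ℕ}
    (hs : s.natDegree ≤ b + 1) (hu : u.natDegree ≤ b) : (X * m).natDegree ≤ b := by
  have h2 : (2 : ℂ[X]) = C 2 := rfl
  have h : (nodePoly c * (2 * (X * m))).natDegree ≤ 2 * e + 2 + b := by
    rw [show nodePoly c * (2 * (X * m)) = X * (T * s - 2 * derivative (nodePoly c) * u) by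
      linear_combination X * hm]
    refine (natDegree_mul_le_of_le natDegree_X_le
      (natDegree_sub_le_of_le (m := 2 * e + 1 + b) (n := 2 * e + 1 + b) ?_ ?_)).trans
        (by omega)
    · exact (natDegree_mul_le_of_le hT hs).trans (by omega)
    · rw [h2]
      refine natDegree_mul_le_of_le ((natDegree_C_mul_le _ _).trans ?_) hu
      exact (natDegree_derivative_le _).trans (by rw [natDegree_nodePoly]; omega)
  have := natDegree_le_of_monic_mul (nodePoly_monic c) ((natDegree_nodePoly c).trans hn) h
  rwa [h2, natDegree_C_mul two_ne_zero] at this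

/-- A compatible pair of small degree, for an equation without logarithmic solutions at all nodes
but one, is zero. -/
theorem Compatible.eq_zero (hc : Function.Injective c) (hn : n = 2 * e + 2) {y : ℂ}
    (hT : HasTop (X ^ 2 * T) (2 * e + 1) (2 * (e + 2) * (e + 1)) y) (i₀ : Fin n)
    (hlog : ∀ i, i ≠ i₀ → NoLog c T i) {s u : ℂ[X]} (h : Compatible c T s u)
    (hs : s.natDegree ≤ e + 1) (hu : u.natDegree ≤ e)
    (hsu : u.coeff e = (e + 2) * s.coeff (e + 1)) : s = 0 ∧ u = 0 := by
  induction hN : s.natDegree using Nat.strong_induction_on generalizing s u with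
  | _ N ih =>
  subst hN
  obtain ⟨m, hm⟩ := h.exists_eq hc
  have hT' := natDegree_accessory_le hT
  have hXm := natDegree_X_mul_connection_le hn hT' hm hs hu
  set t := derivative s - u with ht
  set v := derivative u + m with hv
  have htd : t.natDegree ≤ e :=
    (natDegree_sub_le_of_le ((natDegree_derivative_le s).trans (by omega)) hu).trans (max_self _).le
  have hvd : (X * v).natDegree ≤ e := by
    rw [hv, mul_add]
    exact natDegree_add_le_of_degree_le ((natDegree_X_mul_derivative_le u).trans hu) hXm
  -- The second fundamental form of the line spanned by `(s, u)` has degree at most `2e` and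
  -- vanishes at the `2e + 1` nodes other than `c i₀`.
  have hw : s * v - u * t = 0 := by
    refine eq_zero_of_eval_eq_zero_of_ne hc i₀ (fun i hi => ?_) ?_
    · have h1 := (hlog i hi).compatible_connection hc h hm
      have h2 := h i
      apply (mul_eq_zero.1 (?_ : 2 * (derivative (nodePoly c)).eval (c i) * _ = 0)).resolve_left
        (mul_ne_zero two_ne_zero (eval_derivative_nodePoly_ne_zero hc i))
      simp only [eval_sub, eval_mul] at h1 h2 ⊢
      rw [ht, hv, eval_sub]
      linear_combination -s.eval (c i) * h1 + ((derivative s).eval (c i) - u.eval (c i)) * h2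
    · have h1 : (X * (s * v - u * t)).natDegree ≤ 2 * e + 1 := by
        rw [show X * (s * v - u * t) = s * (X * v) - X * u * t by ring]
        refine (natDegree_sub_le_of_le (n := 2 * e + 1) ?_ ?_).trans (max_self _).le
        · exact (natDegree_mul_le_of_le hs hvd).trans (by omega)
        · exact (natDegree_mul_le_of_le (natDegree_mul_le_of_le natDegree_X_le hu) htd).trans
            (by omega)
      rcases natDegree_X_mul_le h1 with h2 | h2
      · rw [h2]; simp; omega
      · omega
  by_cases hs0 : s = 0
  · subst hs0
    rw [derivative_zero, zero_sub] at ht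
    rw [ht] at hw
    exact ⟨rfl, by simpa using hw⟩
  exfalso
  obtain ⟨k, a, hka, ha, hks, hku⟩ := exists_isCoprime_mul_eq hs0 (sub_eq_zero.1 hw)
  have has : a ∣ s := hka.symm.dvd_of_dvd_mul_left ⟨t, hks⟩
  have hau : a ∣ u := hka.symm.dvd_of_dvd_mul_left ⟨v, hku⟩
  by_cases hau' : IsUnit a
  · obtain ⟨b, hb⟩ := hau'.exists_left_inv
    have h1 : t = b * k * s := by linear_combination -b * hks - t * hb
    have h2 : v = b * k * u := by linear_combination -b * hku - v * hb
    have h3 := eq_zero_of_connection_eq_mul hn hT' hs0 hm h1 h2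
    rw [h3, zero_mul] at h1 h2
    have h4 : u = derivative s := by rw [h1] at ht; exact (sub_eq_zero.1 ht.symm).symm
    have h5 : m = -derivative u := by rw [h2] at hv; linear_combination -hv
    -- Now `s` is a solution of degree `e + 1`, and `hsu` compares `(e + 1)` with `(e + 2)` times
    -- its leading coefficient.
    rcases natDegree_solution hn hT hs0 (by rw [h5, h4] at hm; linear_combination -hm) with h6 | h6
    · rw [h4, coeff_derivative] at hsu
      have h7 : s.coeff (e + 1) = 0 := by linear_combination -hsu
      rw [← h6, coeff_natDegree, leadingCoeff_eq_zero] at h7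
      exact hs0 h7
    · omega
  -- A root of `a` is a common zero of `s` and `u`; dividing it out allows induction on the degree.
  · obtain ⟨z, hz⟩ := IsAlgClosed.exists_root a (fun hd => hau' (isUnit_iff_degree_eq_zero.2 hd))
    have hkz : k.eval z ≠ 0 := by
      intro hkz
      obtain ⟨p, q, hpq⟩ := hka
      have := congrArg (eval z) hpq
      simp [hkz, hz.eq_zero] at this
    obtain ⟨s₁, rfl⟩ : X - C z ∣ s := (dvd_iff_isRoot.2 hz).trans has
    obtain ⟨u₁, rfl⟩ : X - C z ∣ u := (dvd_iff_isRoot.2 hz).trans hau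
    have hs₁ : s₁ ≠ 0 := right_ne_zero_of_mul hs0
    have hsd : ((X - C z) * s₁).natDegree = s₁.natDegree + 1 := by
      rw [natDegree_mul (X_sub_C_ne_zero z) hs₁, natDegree_X_sub_C, add_comm]
    have hud : u₁ = 0 ∨ u₁.natDegree + 1 ≤ e := by
      by_cases h0 : u₁ = 0
      · exact Or.inl h0
      · rw [natDegree_mul (X_sub_C_ne_zero z) h0, natDegree_X_sub_C] at hu; right; omega
    refine hs₁ (ih _ (by omega) (s := s₁) (u := u₁) ?_ (by omega) ?_ ?_ rfl).1
    · intro i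
      by_cases hzi : z = c i
      · subst hzi
        -- At a node the compatibility of `(s₁, u₁)` comes from differentiating `k s = a t` and `k u
        -- = a v` there. No `NoLog` is needed, so `i₀` is allowed.
        have h1 := eval_connection hm i
        have h2 := congrArg (fun p => eval (c i) (derivative p)) hks
        have h3 := congrArg (fun p => eval (c i) (derivative p)) hku
        rw [← hv] at h1
        simp only [ht, derivative_mul, derivative_sub, derivative_X, derivative_C, eval_add,
          eval_mul, eval_sub, eval_X, eval_C, sub_self, zero_mul, mul_zero, hz.eq_zero, sub_zero,
          one_mul, zero_add, add_zero] at h1 h2 h3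
        apply mul_left_cancel₀ hkz
        linear_combination T.eval (c i) * h2 - 2 * (derivative (nodePoly c)).eval (c i) * h3
          - (derivative a).eval (c i) * h1
      · have h1 := h i
        simp only [eval_mul, eval_sub, eval_X, eval_C] at h1
        apply mul_left_cancel₀ (sub_ne_zero.2 (Ne.symm hzi))
        linear_combination h1
    · rcases hud with rfl | h0
      · simp
      · omega
    · rw [coeff_eq_zero_of_natDegree_lt (show s₁.natDegree < e + 1 by omega)]
      rcases hud with rfl | h0
      · simp
      · rw [coeff_eq_zero_of_natDegree_lt (by omega)]; simp

/-! ### Polynomial solutions of the differential equation -/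

/-- `y` is a solution of `2 ω y'' - 2 ω' y' + T y = 0`, where `ω = nodePoly c`. -/
def IsSolution (c : Fin n → ℂ) (T y : ℂ[X]) : Prop :=
  2 * nodePoly c * derivative (derivative y) - 2 * derivative (nodePoly c) * derivative y
    + T * y = 0

theorem HasTop.X_mul {p : ℂ[X]} {k : ℕ} {x y : ℂ} (h : HasTop p k x y) :
    HasTop (X * p) (k + 1) x y :=
  ⟨(natDegree_mul_le_of_le natDegree_X_le h.1).trans (by omega),
    by rw [coeff_X_mul, h.2], by rw [coeff_X_mul, h.3]⟩

/-- Compatible pairs of the critical degree are horizontal. -/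
theorem Compatible.isSolution (hc : Function.Injective c) (hn : n = 2 * e + 2) {y : ℂ}
    (hT : HasTop (X ^ 2 * T) (2 * e + 1) (2 * (e + 2) * (e + 1)) y) (i₀ : Fin n)
    (hlog : ∀ i, i ≠ i₀ → NoLog c T i)
    (hlast : NoLog c T i₀ ∨ y = 2 * (e + 2) * e * (nodePoly c).coeff (2 * e + 1))
    {p q : ℂ[X]} (h : Compatible c T p q)
    (hp : p.natDegree ≤ e + 2) (hq : q.natDegree ≤ e + 1)
    (hpq : q.coeff (e + 1) = (e + 2) * p.coeff (e + 2)) : q = derivative p ∧ IsSolution c T p := by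
  obtain ⟨m, hm⟩ := h.exists_eq hc
  have hω := hasTop_nodePoly (c := c) hn
  have hT' := natDegree_accessory_le hT
  have tp : HasTop p (e + 1) (p.coeff (e + 2)) (p.coeff (e + 1)) := .of_natDegree_le hp
  have tq : HasTop q e ((e + 2) * p.coeff (e + 2)) (q.coeff e) := ⟨hq, hpq, rfl⟩
  have tm : HasTop (X * m) e ((X * m).coeff (e + 1)) ((X * m).coeff e) :=
    .of_natDegree_le (natDegree_X_mul_connection_le hn hT' hm hp hq)
  have h1 := (hω.mul tm.X_mul).const_mul 2
  have h2 := (hT.mul tp).sub ((hω.X_mul_derivative.mul tq.X_mul).const_mul 2)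
  rw [show X ^ 2 * T * p - C 2 * (X * derivative (nodePoly c) * (X * q))
      = C 2 * (nodePoly c * (X * (X * m))) by
    rw [show C (2 : ℂ) = 2 from rfl]; linear_combination (-X ^ 2) * hm] at h2
  obtain ⟨h3, h4⟩ := h1.unique h2
  push_cast at h3 h4
  have h5 : (X * m).coeff (e + 1) = -((e + 1) * (e + 2) * p.coeff (e + 2)) := by
    linear_combination (1 / 2) * h3
  rw [h5] at h4
  have ts := tp.X_mul_derivative.sub tq.X_mul
  have tu := tq.X_mul_derivative.add tm
  rw [← mul_sub] at ts
  rw [← mul_add] at tu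
  set s := derivative p - q with hs
  set u := derivative q + m with hu
  -- The condition `hpq` at infinity makes the expected leading coefficients of both components of
  -- the connection cancel.
  have hs1 : s.coeff (e + 1) = 0 := by
    have := ts.coeff_succ
    rw [coeff_X_mul] at this
    rw [this]; push_cast; ring
  have hu1 : u.coeff e = 0 := by
    have := tu.coeff_succ
    rw [coeff_X_mul, h5] at this
    rw [this]; ring
  have hsd : s.natDegree ≤ e := by
    rw [natDegree_le_iff_coeff_eq_zero]
    intro i hi
    rcases (show e + 1 ≤ i from hi).eq_or_lt with rfl | hi
    · exact hs1
    · rw [← coeff_X_mul]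
      exact coeff_eq_zero_of_natDegree_lt (ts.1.trans_lt (by omega))
  have hud : (X * u).natDegree ≤ e := by
    rw [natDegree_le_iff_coeff_eq_zero]
    intro i hi
    rcases (show e + 1 ≤ i from hi).eq_or_lt with rfl | hi
    · rw [coeff_X_mul, hu1]
    · exact coeff_eq_zero_of_natDegree_lt (tu.1.trans_lt (by omega))
  have hud' : u = 0 ∨ u.natDegree + 1 ≤ e := natDegree_X_mul_le hud
  have hud'' : u.natDegree ≤ e := by
    rcases hud' with h0 | h0
    · simp [h0]
    · omega
  have hsu : s = 0 ∧ u = 0 := by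
    by_cases hl : NoLog c T i₀
    · refine Compatible.eq_zero hc hn hT i₀ hlog (fun i => ?_) (hsd.trans (by omega)) hud'' ?_
      · refine NoLog.compatible_connection hc ?_ h hm
        by_cases hi : i = i₀
        · rwa [hi]
        · exact hlog i hi
      · rw [hu1, hs1, mul_zero]
    · have hy := hlast.resolve_left hl
      -- The factor `X - c i₀` restores compatibility at the bad node at the cost of one degree; the
      -- condition on `y` supplies the required relation between the new top coefficients.
      have := Compatible.eq_zero hc hn hT i₀ hlog (s := (X - C (c i₀)) * s)
        (u := (X - C (c i₀)) * u) (fun i => ?_) ?_ ?_ ?_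
      · exact ⟨(mul_eq_zero.1 this.1).resolve_left (X_sub_C_ne_zero _),
          (mul_eq_zero.1 this.2).resolve_left (X_sub_C_ne_zero _)⟩
      · by_cases hi : i = i₀
        · simp [hi]
        · have := (hlog i hi).compatible_connection hc h hm
          simp only [eval_mul]
          linear_combination (X - C (c i₀)).eval (c i) * this
      · exact (natDegree_mul_le_of_le (natDegree_X_sub_C_le _) hsd).trans (by omega)
      · rcases hud' with h0 | h0
        · simp [h0]
        · exact (natDegree_mul_le_of_le (natDegree_X_sub_C_le _) le_rfl).trans (by omega)
      · rw [sub_mul, sub_mul, coeff_sub, coeff_sub, coeff_C_mul, coeff_C_mul, hu1, hs1,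
          tu.coeff_eq, ts.coeff_eq]
        push_cast
        rw [hy] at h4
        linear_combination (1 / 2) * h4
  have hq : q = derivative p := (sub_eq_zero.1 (hs.symm.trans hsu.1)).symm
  refine ⟨hq, ?_⟩
  have hm0 : m = -derivative q := by rw [hsu.2] at hu; linear_combination -hu
  rw [IsSolution]
  rw [hm0, hq] at hm
  linear_combination -hm

/-- The linear conditions that define the compatible pairs of the critical degree. -/
noncomputable def compatibleMap (c : Fin n → ℂ) (T : ℂ[X]) (e : ℕ) :
    ℂ[X] × ℂ[X] →ₗ[ℂ] (Fin n → ℂ) × ℂ where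
  toFun p := (fun i => T.eval (c i) * p.1.eval (c i)
      - 2 * (derivative (nodePoly c)).eval (c i) * p.2.eval (c i),
    p.2.coeff (e + 1) - (e + 2) * p.1.coeff (e + 2))
  map_add' p q := by
    ext <;> simp <;> ring
  map_smul' a p := by
    ext <;> simp <;> ring

/-- There are `(e + 3) + (e + 2)` unknown coefficients and `(2e + 2) + 1` conditions. Since `q = p'`
on the kernel, projection to `p` preserves independence. -/
theorem exists_solutions (hc : Function.Injective c) (hn : n = 2 * e + 2) {y : ℂ}
    (hT : HasTop (X ^ 2 * T) (2 * e + 1) (2 * (e + 2) * (e + 1)) y) (i₀ : Fin n)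
    (hlog : ∀ i, i ≠ i₀ → NoLog c T i)
    (hlast : NoLog c T i₀ ∨ y = 2 * (e + 2) * e * (nodePoly c).coeff (2 * e + 1)) :
    ∃ P Q : ℂ[X], LinearIndependent ℂ ![P, Q] ∧ P.natDegree ≤ e + 2 ∧ Q.natDegree ≤ e + 2 ∧
      IsSolution c T P ∧ IsSolution c T Q := by
  let ι : (degreeLT ℂ (e + 3) × degreeLT ℂ (e + 2)) →ₗ[ℂ] ℂ[X] × ℂ[X] :=
    (degreeLT ℂ (e + 3)).subtype.prodMap (degreeLT ℂ (e + 2)).subtype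
  let Ψ := compatibleMap c T e ∘ₗ ι
  have fin : ∀ k, Module.Finite ℂ (degreeLT ℂ k) := fun k =>
    Module.Finite.equiv (degreeLTEquiv ℂ k).symm
  have rk : ∀ k, Module.finrank ℂ (degreeLT ℂ k) = k := fun k => by
    rw [(degreeLTEquiv ℂ k).finrank_eq, Module.finrank_fin_fun]
  have hker : 1 < Module.finrank ℂ (LinearMap.ker Ψ) := by
    have h1 := Ψ.finrank_range_add_finrank_ker
    have h2 := (LinearMap.range Ψ).finrank_le
    rw [Module.finrank_prod, rk, rk] at h1
    rw [Module.finrank_prod, Module.finrank_fin_fun, Module.finrank_self] at h2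
    omega
  have hsol : ∀ x : LinearMap.ker Ψ, (x.1.1.1.natDegree ≤ e + 2 ∧ IsSolution c T x.1.1.1) ∧
      (x.1.2.1 = derivative x.1.1.1) := by
    rintro ⟨⟨⟨p, hp⟩, ⟨q, hq⟩⟩, hx⟩
    have hp' : p.natDegree ≤ e + 2 := natDegree_le_iff_coeff_eq_zero.2
      ((degree_lt_iff_coeff_zero _ _).1 (mem_degreeLT.1 hp))
    have hq' : q.natDegree ≤ e + 1 := natDegree_le_iff_coeff_eq_zero.2
      ((degree_lt_iff_coeff_zero _ _).1 (mem_degreeLT.1 hq))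
    have hx' : compatibleMap c T e (p, q) = 0 := hx
    have h1 : Compatible c T p q := fun i => sub_eq_zero.1 (congrFun (congrArg Prod.fst hx') i)
    have h2 : q.coeff (e + 1) = (e + 2) * p.coeff (e + 2) :=
      sub_eq_zero.1 (congrArg Prod.snd hx')
    have := h1.isSolution hc hn hT i₀ hlog hlast hp' hq' h2
    exact ⟨⟨hp', this.2⟩, this.1⟩
  have : Nontrivial (LinearMap.ker Ψ) := Module.nontrivial_of_finrank_pos (R := ℂ) (by omega)
  obtain ⟨x, hx⟩ := exists_ne (0 : LinearMap.ker Ψ)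
  obtain ⟨y, hxy⟩ := exists_linearIndependent_pair_of_one_lt_finrank (R := ℂ)
    (M := LinearMap.ker Ψ) hker hx
  let f : LinearMap.ker Ψ →ₗ[ℂ] ℂ[X] :=
    (degreeLT ℂ (e + 3)).subtype ∘ₗ LinearMap.fst ℂ _ _ ∘ₗ (LinearMap.ker Ψ).subtype
  have hf : LinearMap.ker f = ⊥ := by
    rw [LinearMap.ker_eq_bot']
    intro z hz
    have h1 : z.1.1.1 = 0 := hz
    have h2 := (hsol z).2
    rw [h1, derivative_zero] at h2
    exact Subtype.ext (Prod.ext (Subtype.ext h1) (Subtype.ext h2))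
  refine ⟨x.1.1.1, y.1.1.1, ?_, (hsol x).1.1, (hsol y).1.1, (hsol x).1.2, (hsol y).1.2⟩
  have := hxy.map' f hf
  have hfun : f ∘ ![x, y] = ![(x.1.1.1 : ℂ[X]), y.1.1.1] := by
    funext i
    fin_cases i <;> rfl
  rw [hfun] at this
  exact this

/-! ### The Wronskian and the local degree -/

/-- The numerator `P' Q - P Q'` of the derivative of `P / Q`. -/
noncomputable def wr (P Q : ℂ[X]) : ℂ[X] := derivative P * Q - P * derivative Q

theorem rootMultiplicity_eq_of_eq {p F : ℂ[X]} {a : ℂ} {m : ℕ} (h : p = (X - C a) ^ m * F)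
    (hF : F.eval a ≠ 0) : p.rootMultiplicity a = m := by
  have hF0 : F ≠ 0 := by rintro rfl; simp at hF
  rw [h, rootMultiplicity_mul (mul_ne_zero (pow_ne_zero _ (X_sub_C_ne_zero a)) hF0),
    rootMultiplicity_X_sub_C_pow, rootMultiplicity_eq_zero hF, add_zero]

theorem exists_eq_pow_mul {p : ℂ[X]} (hp : p ≠ 0) (a : ℂ) :
    ∃ F, p = (X - C a) ^ p.rootMultiplicity a * F ∧ F.eval a ≠ 0 := by
  obtain ⟨F, h1, h2⟩ := exists_eq_pow_rootMultiplicity_mul_and_not_dvd p hp a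
  exact ⟨F, h1, fun h => h2 (dvd_iff_isRoot.2 h)⟩

theorem rootMultiplicity_eq_wr {R Q : ℂ[X]} {a : ℂ} (hR : R ≠ 0) (hRa : R.eval a = 0)
    (hQ : Q.eval a ≠ 0) :
    wr R Q ≠ 0 ∧ R.rootMultiplicity a = (wr R Q).rootMultiplicity a + 1 := by
  obtain ⟨U, h1, h2⟩ := exists_eq_pow_mul hR a
  obtain ⟨m, hm⟩ : ∃ m, R.rootMultiplicity a = m + 1 :=
    ⟨R.rootMultiplicity a - 1, (Nat.succ_pred_eq_of_pos ((rootMultiplicity_pos hR).2 hRa)).symm⟩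
  rw [hm] at h1 ⊢
  have h3 : wr R Q = (X - C a) ^ m * (C (m + 1 : ℂ) * U * Q
      + (X - C a) * (derivative U * Q - U * derivative Q)) := by
    rw [wr, h1]
    simp only [derivative_mul, derivative_X_sub_C_pow]
    simp
    ring
  have h4 : (C (m + 1 : ℂ) * U * Q
      + (X - C a) * (derivative U * Q - U * derivative Q)).eval a ≠ 0 := by
    simp only [eval_add, eval_mul, eval_sub, eval_X, eval_C, sub_self, zero_mul, add_zero]
    exact mul_ne_zero (mul_ne_zero (by norm_cast) h2) hQ
  refine ⟨?_, by rw [rootMultiplicity_eq_of_eq h3 h4]⟩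
  intro h5
  rw [h5] at h3
  rcases mul_eq_zero.1 h3.symm with h6 | h6
  · exact pow_ne_zero _ (X_sub_C_ne_zero a) h6
  · rw [h6] at h4; simp at h4

theorem rootMultiplicity_const_mul {p : ℂ[X]} {b : ℂ} (hb : b ≠ 0) (a : ℂ) :
    (C b * p).rootMultiplicity a = p.rootMultiplicity a := by
  by_cases hp : p = 0
  · simp [hp]
  · rw [rootMultiplicity_mul (mul_ne_zero (C_ne_zero.2 hb) hp), rootMultiplicity_C, zero_add]

/-- The combination `R` vanishing at `a` satisfies `wr R Q = Q(a) W` and `wr R P = P(a) W`;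
whichever factor is nonzero is used, so poles need no separate treatment. -/
theorem quotientLocalDegree_eq {P Q : ℂ[X]} {a : ℂ} (hW : wr P Q ≠ 0)
    (h : P.eval a ≠ 0 ∨ Q.eval a ≠ 0) :
    quotientLocalDegree P Q a = (wr P Q).rootMultiplicity a + 1 := by
  rw [quotientLocalDegree]
  set R := C (Q.eval a) * P - C (P.eval a) * Q with hR
  have hRa : R.eval a = 0 := by rw [hR]; simp; ring
  have hRQ : wr R Q = C (Q.eval a) * wr P Q := by rw [hR, wr, wr]; simp; ring
  have hRP : wr R P = C (P.eval a) * wr P Q := by rw [hR, wr, wr]; simp; ring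
  rcases h with h | h
  · have hR0 : R ≠ 0 := by
      intro h0
      rw [h0] at hRP
      exact mul_ne_zero (C_ne_zero.2 h) hW (by rw [← hRP]; simp [wr])
    rw [(rootMultiplicity_eq_wr hR0 hRa h).2, hRP, rootMultiplicity_const_mul h]
  · have hR0 : R ≠ 0 := by
      intro h0
      rw [h0] at hRQ
      exact mul_ne_zero (C_ne_zero.2 h) hW (by rw [← hRQ]; simp [wr])
    rw [(rootMultiplicity_eq_wr hR0 hRa h).2, hRQ, rootMultiplicity_const_mul h]

theorem wr_ne_zero {P Q : ℂ[X]} (h : LinearIndependent ℂ ![P, Q]) : wr P Q ≠ 0 := by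
  have hQ : Q ≠ 0 := h.ne_zero 1
  obtain ⟨a, ha⟩ : ∃ a, Q.eval a ≠ 0 := by
    by_contra! h0
    exact hQ (Polynomial.funext fun a => by simp [h0 a])
  rw [LinearIndependent.pair_iff] at h
  set R := C (Q.eval a) * P - C (P.eval a) * Q with hR
  have hR0 : R ≠ 0 := by
    intro h0
    refine ha (h (Q.eval a) (-P.eval a) ?_).1
    rw [smul_eq_C_mul, smul_eq_C_mul, C_neg, neg_mul, ← sub_eq_add_neg, ← hR, h0]
  have hRa : R.eval a = 0 := by rw [hR]; simp; ring
  have hRQ : wr R Q = C (Q.eval a) * wr P Q := by rw [hR, wr, wr]; simp; ring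
  have := (rootMultiplicity_eq_wr hR0 hRa ha).1
  rw [hRQ] at this
  exact right_ne_zero_of_mul this

/-! ### The Wronskian of two solutions -/

/-- Abel's identity `ωW' = ω'W` makes `W / ω` constant. -/
theorem IsSolution.wr_eq (hc : Function.Injective c) {P Q : ℂ[X]} (hP : IsSolution c T P)
    (hQ : IsSolution c T Q) : ∃ a : ℂ, wr P Q = C a * nodePoly c := by
  rw [IsSolution] at hP hQ
  have h1 : nodePoly c * derivative (wr P Q) = derivative (nodePoly c) * wr P Q := by
    have h2 : derivative (wr P Q)
        = derivative (derivative P) * Q - P * derivative (derivative Q) := by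
      rw [wr, derivative_sub, derivative_mul, derivative_mul]; ring
    rw [h2, wr]
    apply mul_left_cancel₀ (two_ne_zero (α := ℂ[X]))
    linear_combination Q * hP - P * hQ
  obtain ⟨U, hU⟩ := nodePoly_dvd hc (p := wr P Q) fun i => by
    have := congrArg (eval (c i)) h1
    simpa [eval_derivative_nodePoly_ne_zero hc i] using this
  rw [hU, derivative_mul] at h1
  have h2 : derivative U = 0 := by
    have h3 := pow_ne_zero 2 (nodePoly_monic c).ne_zero
    apply (mul_eq_zero.1 (?_ : nodePoly c ^ 2 * _ = 0)).resolve_left h3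
    linear_combination h1
  obtain ⟨a, rfl⟩ := natDegree_eq_zero.1 (derivative_eq_zero.1 h2)
  exact ⟨a, by rw [hU, mul_comm]⟩

/-- In the derivative of the equation at a node the `y''` terms cancel; eliminating `y'` leaves
`NoLog` times `y(c i)`. -/
theorem IsSolution.noLog {y : ℂ[X]} (h : IsSolution c T y) (i : Fin n)
    (hy : y.eval (c i) ≠ 0) : NoLog c T i := by
  rw [IsSolution] at h
  have h0 := congrArg (eval (c i)) h
  have h1 := congrArg (fun p => eval (c i) (derivative p)) h
  simp [derivative_mul] at h0 h1
  rw [NoLog]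
  apply mul_right_cancel₀ hy
  linear_combination 2 * (derivative (nodePoly c)).eval (c i) * h1 +
    (T.eval (c i) - 2 * (derivative (derivative (nodePoly c))).eval (c i)) * h0

/-- The subleading coefficient of `y` drops out because `e + 1` is also a root of the indicial
equation at infinity. -/
theorem IsSolution.hasTop (hn : n = 2 * e + 2) {y : ℂ[X]} (h : IsSolution c T y)
    (hy : y.natDegree = e + 2) :
    HasTop (X ^ 2 * T) (2 * e + 1) (2 * (e + 2) * (e + 1))
      (2 * (e + 2) * e * (nodePoly c).coeff (2 * e + 1)) := by
  have hy0 : y ≠ 0 := by rintro rfl; simp at hy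
  have hlc : y.coeff (e + 1 + 1) ≠ 0 := by
    rwa [show e + 1 + 1 = y.natDegree from hy.symm, coeff_natDegree, leadingCoeff_ne_zero]
  have hω := hasTop_nodePoly (c := c) hn
  have h1 : HasTop y (e + 1) _ _ := .of_natDegree_le hy.le
  have h2 := ((hω.X_mul_derivative.mul h1.X_mul_derivative).const_mul 2).sub
    ((hω.mul h1.X_sq_mul_derivative_derivative).const_mul 2)
  rw [IsSolution] at h
  rw [show C 2 * (X * derivative (nodePoly c) * (X * derivative y))
      - C 2 * (nodePoly c * (X ^ 2 * derivative (derivative y))) = X ^ 2 * T * y by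
    rw [show C (2 : ℂ) = 2 from rfl]; linear_combination (-X ^ 2) * h] at h2
  have h3 : (X ^ 2 * T).natDegree ≤ 2 * e + 1 + 1 := by
    by_cases h0 : X ^ 2 * T = 0
    · simp [h0]
    · have := h2.1
      rw [natDegree_mul h0 hy0] at this
      omega
  have h4 := HasTop.of_natDegree_le h3
  obtain ⟨h5, h6⟩ := (h4.mul h1).unique h2
  push_cast at h5 h6
  have h7 : (X ^ 2 * T).coeff (2 * e + 1 + 1) = (2 * (e + 2) * (e + 1) : ℂ) := by
    apply mul_right_cancel₀ hlc
    linear_combination h5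
  rw [h7] at h6
  refine ⟨h3, h7, ?_⟩
  apply mul_right_cancel₀ hlc
  linear_combination h6

/-- A common zero of `P` and `Q` would be a double zero of `ω`. -/
theorem isCoprime_of_wr_eq (hc : Function.Injective c) {P Q : ℂ[X]} {a : ℂ} (ha : a ≠ 0)
    (h : wr P Q = C a * nodePoly c) : IsCoprime P Q := by
  rw [isCoprime_iff_aeval_ne_zero_of_isAlgClosed ℂ ℂ]
  intro z
  by_contra! h0
  rw [coe_aeval_eq_eval] at h0
  obtain ⟨P₁, rfl⟩ : X - C z ∣ P := dvd_iff_isRoot.2 h0.1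
  obtain ⟨Q₁, rfl⟩ : X - C z ∣ Q := dvd_iff_isRoot.2 h0.2
  have h1 : C a * nodePoly c = (X - C z) ^ 2 * wr P₁ Q₁ := by
    rw [← h, wr, wr]; simp [derivative_mul]; ring
  have h2 := congrArg (eval z) h1
  have h3 := congrArg (fun p => eval z (derivative p)) h1
  simp [derivative_mul, derivative_X_sub_C_pow, ha] at h2 h3
  obtain ⟨i, rfl⟩ := (eval_nodePoly_eq_zero c).1 h2
  exact eval_derivative_nodePoly_ne_zero hc i h3

theorem natDegree_wr_lt {P Q : ℂ[X]} {b : ℕ} (hP : P.natDegree ≤ b + 1) (hQ : Q.natDegree ≤ b + 1) :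
    (wr P Q).natDegree ≤ 2 * b := by
  have tP := HasTop.of_natDegree_le hP
  have tQ := HasTop.of_natDegree_le hQ
  have h := (tP.X_mul_derivative.mul tQ).sub (tP.mul tQ.X_mul_derivative)
  rw [show X * derivative P * Q - P * (X * derivative Q) = X * wr P Q by rw [wr]; ring] at h
  rw [natDegree_le_iff_coeff_eq_zero]
  intro i hi
  rw [← coeff_X_mul]
  rcases (show 2 * b + 1 ≤ i from hi).eq_or_lt with rfl | hi
  · rw [show 2 * b + 1 + 1 = b + b + 1 + 1 by ring, h.coeff_succ]; ring
  · exact coeff_eq_zero_of_natDegree_lt (h.1.trans_lt (by omega))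

/-! ### The Schwarzian derivative in terms of numerator and denominator -/

theorem deriv_eq_of_eq_div {g : ℂ → ℂ} {N Q : ℂ[X]} {k : ℕ}
    (hg : ∀ z, Q.eval z ≠ 0 → g z = N.eval z / Q.eval z ^ k) (z : ℂ) (hz : Q.eval z ≠ 0) :
    deriv g z = (derivative N * Q - C (k : ℂ) * N * derivative Q).eval z / Q.eval z ^ (k + 1) := by
  have h1 : g =ᶠ[𝓝 z] fun w => N.eval w / Q.eval w ^ k := by
    filter_upwards [Q.continuous.continuousAt.eventually_ne hz] with w hw using hg w hw
  rw [h1.deriv_eq]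
  have h2 := (N.hasDerivAt z).div ((Q.hasDerivAt z).pow k) (pow_ne_zero k hz)
  refine h2.deriv.trans ?_
  simp only [eval_sub, eval_mul, eval_C, Pi.pow_apply]
  rcases k with _ | k
  · simp; field_simp
  · simp only [Nat.add_sub_cancel]
    field_simp
    ring

theorem value_eq (f : RatFunc ℂ) (z : ℂ) : value f z = f.num.eval z / f.denom.eval z := by
  rw [value, RatFunc.eval, eval₂_id, eval₂_id]

/-- From `f' = W / Q²` one gets `f''/f' = W'/W - 2Q'/Q`; in the Schwarzian the `Q'²` terms cancel,
leaving an equation linear in `Q`. -/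
theorem schwarzianExpr_mul (f : RatFunc ℂ) {z : ℂ} {W : ℂ[X]} (hW : wr f.num f.denom = W)
    (hz : f.denom.eval z ≠ 0) (hWz : W.eval z ≠ 0) :
    schwarzianExpr (value f) z * (W ^ 2 * f.denom).eval z =
      (W * derivative (derivative W) * f.denom - C (3 / 2) * derivative W ^ 2 * f.denom
        - 2 * W ^ 2 * derivative (derivative f.denom)
        + 2 * W * derivative W * derivative f.denom).eval z := by
  have h0 : ∀ z, f.denom.eval z ≠ 0 → value f z = f.num.eval z / f.denom.eval z ^ 1 :=
    fun z _ => by rw [value_eq, pow_one]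
  have h1 : ∀ z, f.denom.eval z ≠ 0 → deriv (value f) z = W.eval z / f.denom.eval z ^ 2 := by
    intro z hz
    rw [deriv_eq_of_eq_div h0 z hz, ← hW, wr]
    simp
  have h2 := deriv_eq_of_eq_div h1
  have h3 := deriv_eq_of_eq_div h2
  rw [schwarzianExpr, iteratedDeriv_succ, iteratedDeriv_succ, iteratedDeriv_one, h1 z hz,
    h2 z hz, h3 z hz]
  simp only [eval_sub, eval_mul, eval_C, eval_add, eval_pow, derivative_mul, derivative_sub,
    derivative_C, eval_ofNat, eval_zero]
  field_simp
  push_cast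
  ring

/-! ### From the Schwarzian derivative to the differential equation -/

theorem wr_num_denom_ne_zero {f : RatFunc ℂ} (hf : 0 < degree f) : wr f.num f.denom ≠ 0 := by
  intro h
  have h1 : wronskian f.num f.denom = 0 := by
    rw [wronskian]; rw [wr] at h; linear_combination -h
  obtain ⟨h2, h3⟩ := f.isCoprime_num_denom.wronskian_eq_zero_iff.1 h1
  rw [degree, derivative_eq_zero.1 h2, derivative_eq_zero.1 h3] at hf
  simp at hf

theorem IsSchwarzianPrimitive.mul_eq {d : ℕ} {f : RatFunc ℂ} (hd : 0 < d)
    (hf : IsSchwarzianPrimitive c A d f) {W : ℂ[X]} (hW : wr f.num f.denom = W) :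
    nodePoly c ^ 2 * (W * derivative (derivative W) * f.denom
        - C (3 / 2) * derivative W ^ 2 * f.denom - 2 * W ^ 2 * derivative (derivative f.denom)
        + 2 * W * derivative W * derivative f.denom) = phiNum c A * (W ^ 2 * f.denom) := by
  have hW0 : W ≠ 0 := hW ▸ wr_num_denom_ne_zero (hf.1.symm ▸ hd)
  -- Multiplication by `ω Q W` makes the identity trivial at the points where the Schwarzian formula
  -- is unavailable.
  have h0 : nodePoly c * (f.denom * W) ≠ 0 :=
    mul_ne_zero (nodePoly_monic c).ne_zero (mul_ne_zero f.denom_ne_zero hW0)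
  apply mul_left_cancel₀ h0
  refine Polynomial.funext fun z => ?_
  rw [eval_mul, eval_mul (p := nodePoly c * (f.denom * W))]
  by_cases hz : (nodePoly c * (f.denom * W)).eval z = 0
  · rw [hz, zero_mul, zero_mul]
  · congr 1
    simp only [eval_mul, mul_eq_zero, not_or] at hz
    obtain ⟨h1, h2, h3⟩ := hz
    have h4 : ∀ i, z ≠ c i := fun i hi => h1 ((eval_nodePoly_eq_zero c).2 ⟨i, hi⟩)
    have h5 := hf.2 z h4
    rw [schwarzian, if_pos h2] at h5
    rw [eval_mul, ← schwarzianExpr_mul f hW h2 h3, h5, eval_mul (p := phiNum c A),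
      eval_phiNum A z h4, eval_pow]
    ring

/-- The same identity for numerator and denominator. -/
theorem mul_eq_symm {P Q W Φ ω : ℂ[X]} (hQ : Q ≠ 0) (hW : wr P Q = W)
    (h : ω ^ 2 * (W * derivative (derivative W) * Q
        - C (3 / 2) * derivative W ^ 2 * Q - 2 * W ^ 2 * derivative (derivative Q)
        + 2 * W * derivative W * derivative Q) = Φ * (W ^ 2 * Q)) :
    ω ^ 2 * (W * derivative (derivative W) * P
        - C (3 / 2) * derivative W ^ 2 * P - 2 * W ^ 2 * derivative (derivative P)
        + 2 * W * derivative W * derivative P) = Φ * (W ^ 2 * P) := by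
  apply mul_left_cancel₀ hQ
  have h1 : derivative W = derivative (derivative P) * Q - P * derivative (derivative Q) := by
    rw [← hW, wr]; simp only [derivative_sub, derivative_mul]; ring
  have h2 : W = derivative P * Q - P * derivative Q := hW.symm
  have h3 : Q * (derivative W * derivative P - W * derivative (derivative P))
      = P * (derivative W * derivative Q - W * derivative (derivative Q)) := by
    rw [h1, h2]; ring
  linear_combination P * h + 2 * ω ^ 2 * W * h3

theorem X_sub_C_mul_derivative_pow_mul (a : ℂ) (j : ℕ) (F : ℂ[X]) :
    (X - C a) * derivative ((X - C a) ^ j * F)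
      = (X - C a) ^ j * (C (j : ℂ) * F + (X - C a) * derivative F) := by
  rcases j with _ | j
  · simp
  · rw [derivative_mul, derivative_X_sub_C_pow]
    simp
    ring

/-- Cancelling the powers of `X - a` in the differential equation for the Wronskian. -/
theorem mul_eq_of_eq_pow_mul {p W Φ ω U : ℂ[X]} {a : ℂ} {j : ℕ}
    (h : ω ^ 2 * (W * derivative (derivative W) * p
        - C (3 / 2) * derivative W ^ 2 * p - 2 * W ^ 2 * derivative (derivative p)
        + 2 * W * derivative W * derivative p) = Φ * (W ^ 2 * p))
    (hU : W = (X - C a) ^ (j + 1) * U) : ∃ G : ℂ[X],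
    ω ^ 2 * (C (-(((j : ℂ) + 1) * (j + 3) / 2)) * U ^ 2 * p + (X - C a) * G)
      = Φ * ((X - C a) ^ 2 * U ^ 2 * p) := by
  set t := X - C a with ht
  set F := C ((j : ℂ) + 1) * U + t * derivative U with hF
  have h1 : derivative W = t ^ j * F := by
    apply mul_left_cancel₀ (X_sub_C_ne_zero a)
    rw [hU, X_sub_C_mul_derivative_pow_mul, hF]
    push_cast
    ring
  have h2 : t * derivative (derivative W) = t ^ j * (C (j : ℂ) * F + t * derivative F) := by
    rw [h1, X_sub_C_mul_derivative_pow_mul]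
  refine ⟨C (j : ℂ) * U * derivative U * p + U * derivative F * p
    - C (3 / 2) * (2 * C ((j : ℂ) + 1) * U * derivative U + t * derivative U ^ 2) * p
    + 2 * U * F * derivative p - 2 * t * U ^ 2 * derivative (derivative p), ?_⟩
  have h3 : t ^ (2 * j) ≠ 0 := pow_ne_zero _ (X_sub_C_ne_zero a)
  apply mul_left_cancel₀ h3
  have h4 : W * derivative (derivative W)
      = t ^ (2 * j) * (U * (C (j : ℂ) * F + t * derivative F)) := by
    linear_combination derivative (derivative W) * hU + t ^ j * U * h2
  -- For a zero of order `k = j + 1` of `W`, the leading coefficient is `k(k - 1) - (3/2)k² = -k(k +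
  -- 2)/2`.
  have h5 : C (-(((j : ℂ) + 1) * (j + 3) / 2)) = C (j : ℂ) * C ((j : ℂ) + 1)
      - C (3 / 2) * C ((j : ℂ) + 1) ^ 2 := by
    rw [← C_mul, ← C_pow, ← C_mul, ← C_sub]; congr 1; ring
  rw [h4, h1, hU] at h
  rw [h5]
  rw [hF] at h ⊢
  linear_combination h

/-- Comparison with the double pole coefficient `-3/2` of `φ` gives `(j + 1)(j + 3) = 3`, so `j =
0`. -/
theorem rootMultiplicity_node (hc : Function.Injective c) {p W : ℂ[X]} {i : Fin n} (hW : W ≠ 0)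
    (hp : p.eval (c i) ≠ 0)
    (h : nodePoly c ^ 2 * (W * derivative (derivative W) * p
        - C (3 / 2) * derivative W ^ 2 * p - 2 * W ^ 2 * derivative (derivative p)
        + 2 * W * derivative W * derivative p) = phiNum c A * (W ^ 2 * p)) :
    W.rootMultiplicity (c i) = 1 := by
  have hψ := eval_cofactor_ne_zero hc i
  have hΦ : (phiNum c A).eval (c i) = -(3 / 2) * (cofactor c i).eval (c i) ^ 2 := by
    obtain ⟨G, hG, -⟩ := phiNum_eq A (c := c) i
    rw [hG]; simp
  obtain ⟨U, h1, h2⟩ := exists_eq_pow_mul hW (c i)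
  rcases hk : W.rootMultiplicity (c i) with _ | j
  · rw [hk, pow_zero, one_mul] at h1
    have h3 := congrArg (eval (c i)) h
    simp [hΦ, hp, hψ, h1, h2] at h3
  · rw [hk] at h1
    obtain ⟨G, hG⟩ := mul_eq_of_eq_pow_mul h h1
    have h3 : cofactor c i ^ 2 * (C (-(((j : ℂ) + 1) * (j + 3) / 2)) * U ^ 2 * p
        + (X - C (c i)) * G) = phiNum c A * (U ^ 2 * p) := by
      apply mul_left_cancel₀ (pow_ne_zero 2 (X_sub_C_ne_zero (c i)))
      rw [nodePoly_eq c i] at hG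
      linear_combination hG
    have h4 := congrArg (eval (c i)) h3
    simp only [eval_mul, eval_add, eval_sub, eval_pow, eval_C, eval_X, hΦ] at h4
    have h5 : (j : ℂ) * (j + 4) = 0 := by
      have h6 : ((cofactor c i).eval (c i) ^ 2 * U.eval (c i) ^ 2 * p.eval (c i))
          * ((j : ℂ) * (j + 4)) = 0 := by
        linear_combination (-2) * h4
      simpa [hψ, h2, hp] using h6
    have h6 : j * (j + 4) = 0 := by exact_mod_cast h5
    simp at h6
    rw [h6]

theorem eval_ne_zero_of_ne_node {p W : ℂ[X]} {z : ℂ} (hW : W ≠ 0) (hz : ∀ i, z ≠ c i)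
    (hp : p.eval z ≠ 0)
    (h : nodePoly c ^ 2 * (W * derivative (derivative W) * p
        - C (3 / 2) * derivative W ^ 2 * p - 2 * W ^ 2 * derivative (derivative p)
        + 2 * W * derivative W * derivative p) = phiNum c A * (W ^ 2 * p)) :
    W.eval z ≠ 0 := by
  intro hWz
  obtain ⟨U, h1, h2⟩ := exists_eq_pow_mul hW z
  rcases hk : W.rootMultiplicity z with _ | j
  · rw [hk, pow_zero, one_mul] at h1
    rw [h1] at hWz
    exact h2 hWz
  · rw [hk] at h1
    obtain ⟨G, hG⟩ := mul_eq_of_eq_pow_mul h h1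
    have h4 := congrArg (eval z) hG
    have h5 : (nodePoly c).eval z ≠ 0 := fun h0 => by
      obtain ⟨i, hi⟩ := (eval_nodePoly_eq_zero c).1 h0
      exact hz i hi
    have h6 : ((j : ℂ) + 1) * (j + 3) ≠ 0 := by norm_cast
    simp [h5, h2, hp] at h4
    rcases h4 with h4 | h4
    · norm_cast at h4
    · norm_cast at h4

theorem IsSchwarzianPrimitive.isSolution (hc : Function.Injective c) {d : ℕ} {f : RatFunc ℂ}
    (hd : 0 < d) (hT : IsAccessory c A T) (hf : IsSchwarzianPrimitive c A d f) :
    (∃ a : ℂ, a ≠ 0 ∧ wr f.num f.denom = C a * nodePoly c) ∧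
      IsSolution c T f.num ∧ IsSolution c T f.denom := by
  set W := wr f.num f.denom with hW
  have hW0 : W ≠ 0 := wr_num_denom_ne_zero (hf.1.symm ▸ hd)
  have hQ := hf.mul_eq hd hW.symm
  have hP := mul_eq_symm f.denom_ne_zero hW.symm hQ
  have hPQ : ∀ z, f.num.eval z ≠ 0 ∨ f.denom.eval z ≠ 0 :=
    (isCoprime_iff_aeval_ne_zero_of_isAlgClosed ℂ ℂ _ _).1 f.isCoprime_num_denom
  have hroot : ∀ i, W.rootMultiplicity (c i) = 1 := fun i =>
    (hPQ (c i)).elim (fun h => rootMultiplicity_node hc hW0 h hP)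
      (fun h => rootMultiplicity_node hc hW0 h hQ)
  have hne : ∀ z, (∀ i, z ≠ c i) → W.eval z ≠ 0 := fun z hz =>
    (hPQ z).elim (fun h => eval_ne_zero_of_ne_node hW0 hz h hP)
      (fun h => eval_ne_zero_of_ne_node hW0 hz h hQ)
  obtain ⟨U, hU⟩ := nodePoly_dvd hc (p := W) fun i => by
    have := (rootMultiplicity_pos hW0).1 (by rw [hroot i]; exact one_pos)
    exact this
  have hUd : U.degree = 0 := by
    by_contra hUd
    obtain ⟨z, hz⟩ := IsAlgClosed.exists_root U hUd
    by_cases hzc : ∀ i, z ≠ c i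
    · exact hne z hzc (by rw [hU, eval_mul, hz.eq_zero, mul_zero])
    · push Not at hzc
      obtain ⟨i, rfl⟩ := hzc
      obtain ⟨V, rfl⟩ := dvd_iff_isRoot.2 hz
      have h1 : (X - C (c i)) ^ 2 ∣ W := by
        rw [hU, nodePoly_eq c i]
        exact ⟨cofactor c i * V, by ring⟩
      have h2 := (le_rootMultiplicity_iff hW0).2 h1
      rw [hroot i] at h2
      omega
  obtain ⟨a, rfl⟩ : ∃ a, U = C a := ⟨_, eq_C_of_degree_eq_zero hUd⟩
  have ha : a ≠ 0 := by rintro rfl; simp at hUd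
  have hWa : W = C a * nodePoly c := by rw [hU, mul_comm]
  have sol : ∀ p : ℂ[X], nodePoly c ^ 2 * (W * derivative (derivative W) * p
        - C (3 / 2) * derivative W ^ 2 * p - 2 * W ^ 2 * derivative (derivative p)
        + 2 * W * derivative W * derivative p) = phiNum c A * (W ^ 2 * p) →
      IsSolution c T p := by
    intro p hp
    rw [hWa] at hp
    simp only [derivative_mul, derivative_C, zero_mul, zero_add] at hp
    rw [IsAccessory] at hT
    rw [IsSolution]
    have h1 : C a ^ 2 * nodePoly c ^ 3 ≠ 0 :=
      mul_ne_zero (pow_ne_zero _ (C_ne_zero.2 ha)) (pow_ne_zero _ (nodePoly_monic c).ne_zero)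
    apply (mul_eq_zero.1 (?_ : C a ^ 2 * nodePoly c ^ 3 * _ = 0)).resolve_left h1
    linear_combination C a ^ 2 * nodePoly c ^ 2 * p * hT - hp
  exact ⟨⟨a, ha, hWa⟩, sol _ hP, sol _ hQ⟩

/-! ### From the differential equation to the rational map -/

theorem IsSolution.of_const_mul {b : ℂ} (hb : b ≠ 0) {y : ℂ[X]} (h : IsSolution c T (C b * y)) :
    IsSolution c T y := by
  rw [IsSolution] at h ⊢
  simp only [derivative_mul, derivative_C, zero_mul, zero_add] at h
  apply (mul_eq_zero.1 (?_ : C b * _ = 0)).resolve_left (C_ne_zero.2 hb)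
  linear_combination h

theorem exists_num_denom_eq {P Q : ℂ[X]} (h : IsCoprime P Q) (hQ : Q ≠ 0) :
    ∃ (f : RatFunc ℂ) (b : ℂ), b ≠ 0 ∧ P = C b * f.num ∧ Q = C b * f.denom := by
  set f : RatFunc ℂ := algebraMap ℂ[X] (RatFunc ℂ) P / algebraMap ℂ[X] (RatFunc ℂ) Q with hf
  have h1 : f.num * Q = P * f.denom := (RatFunc.num_mul_eq_mul_denom_iff hQ).2 hf
  obtain ⟨r, hr⟩ : f.denom ∣ Q := f.isCoprime_num_denom.symm.dvd_of_dvd_mul_left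
    ⟨P, by rw [h1, mul_comm]⟩
  have hr' : P = f.num * r := by
    apply mul_right_cancel₀ f.denom_ne_zero
    rw [← h1, hr]; ring
  have hu : IsUnit r := h.isUnit_of_dvd' ⟨f.num, by rw [hr', mul_comm]⟩
    ⟨f.denom, by rw [hr, mul_comm]⟩
  obtain ⟨b, hb, rfl⟩ := Polynomial.isUnit_iff.1 hu
  exact ⟨f, b, hb.ne_zero, by rw [hr', mul_comm], by rw [hr, mul_comm]⟩

theorem continuousAt_phi {z : ℂ} (hz : ∀ i, z ≠ c i) : ContinuousAt (phi c A) z := by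
  unfold phi
  refine ContinuousAt.mul continuousAt_const (tendsto_finsetSum _ fun i _ => ?_)
  have : (z - c i) ^ 2 ≠ 0 := pow_ne_zero _ (sub_ne_zero.2 (hz i))
  exact ContinuousAt.div (by fun_prop) (by fun_prop) this

theorem schwarzianExpr_eq_phi (hT : IsAccessory c A T) {f : RatFunc ℂ} {a : ℂ} (ha : a ≠ 0)
    (hW : wr f.num f.denom = C a * nodePoly c) (hQ : IsSolution c T f.denom) {z : ℂ}
    (hz : ∀ i, z ≠ c i) (hQz : f.denom.eval z ≠ 0) : schwarzianExpr (value f) z = phi c A z := by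
  have hω : (nodePoly c).eval z ≠ 0 := fun h0 => by
    obtain ⟨i, hi⟩ := (eval_nodePoly_eq_zero c).1 h0
    exact hz i hi
  have h1 := schwarzianExpr_mul f hW hQz (by simp [ha, hω])
  rw [IsAccessory] at hT
  rw [IsSolution] at hQ
  set ω := nodePoly c
  have h2 : C a * ω * derivative (derivative (C a * ω)) * f.denom
        - C (3 / 2) * derivative (C a * ω) ^ 2 * f.denom
        - 2 * (C a * ω) ^ 2 * derivative (derivative f.denom)
        + 2 * (C a * ω) * derivative (C a * ω) * derivative f.denom
      = C a ^ 2 * phiNum c A * f.denom := by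
    simp only [derivative_mul, derivative_C, zero_mul, zero_add]
    linear_combination C a ^ 2 * f.denom * hT - C a ^ 2 * ω * hQ
  rw [h2] at h1
  simp only [eval_mul, eval_pow, eval_C, eval_phiNum A z hz] at h1
  have h3 : a ^ 2 * (nodePoly c).eval z ^ 2 * f.denom.eval z ≠ 0 :=
    mul_ne_zero (mul_ne_zero (pow_ne_zero _ ha) (pow_ne_zero _ hω)) hQz
  apply mul_right_cancel₀ h3
  linear_combination h1

theorem schwarzian_eq_phi (hT : IsAccessory c A T) {f : RatFunc ℂ} {a : ℂ} (ha : a ≠ 0)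
    (hW : wr f.num f.denom = C a * nodePoly c) (hQ : IsSolution c T f.denom) {z : ℂ}
    (hz : ∀ i, z ≠ c i) : schwarzian f z = phi c A z := by
  rw [schwarzian]
  split_ifs with h
  · exact schwarzianExpr_eq_phi hT ha hW hQ hz h
  · refine Tendsto.limUnder_eq (((continuousAt_phi hz).tendsto.mono_left
      nhdsWithin_le_nhds).congr' ?_)
    have h1 : ∀ᶠ w in 𝓝[≠] z, ∀ i, w ≠ c i := by
      rw [eventually_all]
      exact fun i => nhdsWithin_le_nhds (eventually_ne_nhds (hz i))
    have h2 : ∀ᶠ w in 𝓝[≠] z, f.denom.eval w ≠ 0 := by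
      have hfin : ((f.denom.roots.toFinset.erase z : Finset ℂ) : Set ℂ)ᶜ ∈ 𝓝 z :=
        (Finset.finite_toSet _).isClosed.isOpen_compl.mem_nhds (by simp)
      filter_upwards [nhdsWithin_le_nhds hfin, self_mem_nhdsWithin] with w hw hwz h0
      refine hw ?_
      simp only [Finset.coe_erase, Set.mem_sdiff, Finset.mem_coe, Multiset.mem_toFinset]
      exact ⟨(mem_roots f.denom_ne_zero).2 h0, hwz⟩
    filter_upwards [h1, h2] with w hw1 hw2
    exact (schwarzianExpr_eq_phi hT ha hW hQ hw1 hw2).symm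

theorem exists_isSchwarzianPrimitive (hc : Function.Injective c) (hn : n = 2 * e + 2)
    (hT : IsAccessory c A T) {y : ℂ}
    (hTop : HasTop (X ^ 2 * T) (2 * e + 1) (2 * (e + 2) * (e + 1)) y) (i₀ : Fin n)
    (hlog : ∀ i, i ≠ i₀ → NoLog c T i)
    (hlast : NoLog c T i₀ ∨ y = 2 * (e + 2) * e * (nodePoly c).coeff (2 * e + 1)) :
    ∃ f, IsSchwarzianPrimitive c A (e + 2) f := by
  obtain ⟨P, Q, hPQ, hPd, hQd, hP, hQ⟩ := exists_solutions hc hn hTop i₀ hlog hlast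
  obtain ⟨a, hW⟩ := hP.wr_eq hc hQ
  have ha : a ≠ 0 := by
    rintro rfl
    exact wr_ne_zero hPQ (by rw [hW, C_0, zero_mul])
  obtain ⟨f, b, hb, rfl, rfl⟩ := exists_num_denom_eq (isCoprime_of_wr_eq hc ha hW) (hPQ.ne_zero 1)
  have hWf : wr f.num f.denom = C (a / b ^ 2) * nodePoly c := by
    have h1 : C (b ^ 2) * wr f.num f.denom = C a * nodePoly c := by
      rw [← hW, wr, wr]; simp only [derivative_mul, derivative_C, C_pow]; ring
    apply mul_left_cancel₀ (C_ne_zero.2 (pow_ne_zero 2 hb))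
    rw [h1, ← mul_assoc, ← C_mul, mul_div_cancel₀ _ (pow_ne_zero 2 hb)]
  have hab : a / b ^ 2 ≠ 0 := div_ne_zero ha (pow_ne_zero 2 hb)
  rw [natDegree_C_mul hb] at hPd hQd
  refine ⟨f, ?_, fun z hz => schwarzian_eq_phi hT hab hWf (hQ.of_const_mul hb) hz⟩
  -- Numerator and denominator of degree at most `e + 1` would have a Wronskian of degree at most
  -- `2e`, not `2e + 2`.
  refine le_antisymm (max_le hPd hQd) ?_
  by_contra! h
  rw [degree, max_lt_iff] at h
  have h1 := natDegree_wr_lt (b := e) (Nat.le_of_lt_succ h.1) (Nat.le_of_lt_succ h.2)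
  rw [hWf, natDegree_C_mul hab, natDegree_nodePoly] at h1
  omega

/-! ### The local degrees of a rational map with the given Schwarzian derivative -/

theorem isSimpleCriticalPoint_node (hc : Function.Injective c) {f : RatFunc ℂ} {a : ℂ}
    (ha : a ≠ 0) (hW : wr f.num f.denom = C a * nodePoly c) (i : Fin n) :
    IsSimpleCriticalPoint f (c i : OnePoint ℂ) := by
  have hPQ : f.num.eval (c i) ≠ 0 ∨ f.denom.eval (c i) ≠ 0 :=
    (isCoprime_iff_aeval_ne_zero_of_isAlgClosed ℂ ℂ _ _).1 f.isCoprime_num_denom (c i)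
  have hW0 : wr f.num f.denom ≠ 0 := by
    rw [hW]; exact mul_ne_zero (C_ne_zero.2 ha) (nodePoly_monic c).ne_zero
  change quotientLocalDegree f.num f.denom (c i) = 2
  rw [quotientLocalDegree_eq hW0 hPQ, hW, rootMultiplicity_const_mul ha,
    rootMultiplicity_eq_of_eq (m := 1) (by rw [pow_one]; exact nodePoly_eq c i)
      (eval_cofactor_ne_zero hc i)]

theorem eval_reflect_zero (p : ℂ[X]) (d : ℕ) : (p.reflect d).eval 0 = p.coeff d := by
  rw [← coeff_zero_eq_eval_zero, coeff_reflect, revAt_le (Nat.zero_le d), Nat.sub_zero]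

theorem eval_derivative_reflect_zero (p : ℂ[X]) (d : ℕ) :
    (derivative (p.reflect (d + 1))).eval 0 = p.coeff d := by
  rw [← coeff_zero_eq_eval_zero, coeff_derivative, coeff_reflect, revAt_le (by omega)]
  simp

/-- The Wronskian of the reflected polynomials at 0 is minus the coefficient of degree `2e + 2` of
`W`, that is `-a`. -/
theorem isRegularPoint_infty (hn : n = 2 * e + 2) {f : RatFunc ℂ} (hf : degree f = e + 2) {a : ℂ}
    (ha : a ≠ 0) (hW : wr f.num f.denom = C a * nodePoly c) :
    IsRegularPoint f OnePoint.infty := by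
  have tP : HasTop f.num (e + 1) _ _ := .of_natDegree_le ((le_max_left _ _).trans hf.le)
  have tQ : HasTop f.denom (e + 1) _ _ := .of_natDegree_le ((le_max_right _ _).trans hf.le)
  have h := ((tP.X_mul_derivative.mul tQ).sub (tP.mul tQ.X_mul_derivative)).coeff_eq
  rw [show X * derivative f.num * f.denom - f.num * (X * derivative f.denom)
      = C a * (X * nodePoly c) by rw [wr] at hW; linear_combination X * hW,
    coeff_C_mul, show e + 1 + (e + 1) + 1 = (2 * e + 1 + 1) + 1 by ring, coeff_X_mul,
    (hasTop_nodePoly hn).coeff_succ] at h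
  push_cast at h
  change quotientLocalDegree (f.num.reflect (degree f)) (f.denom.reflect (degree f)) 0 = 1
  rw [hf]
  have h1 : (wr (f.num.reflect (e + 2)) (f.denom.reflect (e + 2))).eval 0 ≠ 0 := by
    rw [wr, eval_sub, eval_mul, eval_mul, eval_reflect_zero, eval_reflect_zero,
      eval_derivative_reflect_zero, eval_derivative_reflect_zero]
    intro h0
    exact ha (by linear_combination h - h0)
  rw [quotientLocalDegree_eq (fun h0 => h1 (by rw [h0, eval_zero])), rootMultiplicity_eq_zero h1]
  by_contra! h0
  refine h1 ?_
  rw [wr, eval_sub, eval_mul, eval_mul, h0.1, h0.2]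
  ring

end RationalSchwarzian

/-! ### The equivalence of the four problems -/

open RationalSchwarzian in
theorem theorem1p2 (d : ℕ) (hd : 2 ≤ d) (c : Fin (2 * d - 2) → ℂ) (hc : Function.Injective c)
    (A : Fin (2 * d - 2) → ℂ) :
    List.TFAE
      [ ∃ f : RatFunc ℂ, RationalSchwarzian.IsSchwarzianPrimitive c A d f,
        (∀ i, RationalSchwarzian.L c A i = 0) ∧
          RationalSchwarzian.E c A 0 = 0 ∧ RationalSchwarzian.E c A 1 = 0 ∧
          RationalSchwarzian.E c A 2 = 0,
        (∀ i : Fin (2 * d - 2), (i : ℕ) + 1 ≤ 2 * d - 3 → RationalSchwarzian.L c A i = 0) ∧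
          RationalSchwarzian.E c A 0 = 0 ∧ RationalSchwarzian.E c A 1 = 0 ∧
          RationalSchwarzian.E c A 2 = 0,
        (∀ i, RationalSchwarzian.L c A i = 0) ∧
          RationalSchwarzian.E c A 0 = 0 ∧ RationalSchwarzian.E c A 1 = 0 ] ∧
    ∀ f : RatFunc ℂ, RationalSchwarzian.IsSchwarzianPrimitive c A d f →
      (∀ i, RationalSchwarzian.IsSimpleCriticalPoint f (c i : OnePoint ℂ)) ∧
        RationalSchwarzian.IsRegularPoint f OnePoint.infty := by
  obtain ⟨e, rfl⟩ : ∃ e, d = e + 2 := ⟨d - 2, by omega⟩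
  have hn : 2 * (e + 2) - 2 = 2 * e + 2 := by omega
  obtain ⟨T, hT⟩ := exists_isAccessory hc A
  have hlogL := noLog_iff hc hT
  let i₀ : Fin (2 * (e + 2) - 2) := ⟨2 * e + 1, by omega⟩
  refine ⟨?_, fun f hf => ?_⟩
  · tfae_have 1 → 2 := by
      rintro ⟨f, hf⟩
      obtain ⟨-, hP, hQ⟩ := hf.isSolution hc (by omega) hT
      have hPQ : ∀ z, f.num.eval z ≠ 0 ∨ f.denom.eval z ≠ 0 :=
        (isCoprime_iff_aeval_ne_zero_of_isAlgClosed ℂ ℂ _ _).1 f.isCoprime_num_denom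
      refine ⟨fun i => (hlogL i).1 ((hPQ (c i)).elim (hP.noLog i) (hQ.noLog i)), ?_⟩
      apply E_eq_zero_of_hasTop hn hT
      have hdeg : max f.num.natDegree f.denom.natDegree = e + 2 := hf.1
      rcases max_choice f.num.natDegree f.denom.natDegree with h | h
      · exact hP.hasTop hn (h.symm.trans hdeg)
      · exact hQ.hasTop hn (h.symm.trans hdeg)
    tfae_have 2 → 3 := fun ⟨h, h'⟩ => ⟨fun i _ => h i, h'⟩
    tfae_have 2 → 4 := fun ⟨h, h0, h1, _⟩ => ⟨h, h0, h1⟩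
    tfae_have 3 → 1 := by
      rintro ⟨h, h0, h1, h2⟩
      -- The condition `E_3 = 0` at infinity stands in for the missing one at the last node `i₀`.
      refine exists_isSchwarzianPrimitive hc hn hT
        (hasTop_accessory hn hT (natDegree_phiNum_le hn h0 h1)) i₀ (fun i hi => ?_) (Or.inr ?_)
      · have : (i : ℕ) ≠ 2 * e + 1 := fun h => hi (Fin.ext h)
        exact (hlogL i).2 (h i (by omega))
      · rw [coeff_phiNum_eq_zero hn h0 h1 h2, add_zero]
    tfae_have 4 → 1 := by
      rintro ⟨h, h0, h1⟩
      exact exists_isSchwarzianPrimitive hc hn hT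
        (hasTop_accessory hn hT (natDegree_phiNum_le hn h0 h1)) i₀ (fun i _ => (hlogL i).2 (h i))
        (Or.inl ((hlogL i₀).2 (h i₀)))
    tfae_finish
  · obtain ⟨⟨a, ha, hW⟩, -, -⟩ := hf.isSolution hc (by omega) hT
    exact ⟨isSimpleCriticalPoint_node hc ha hW, isRegularPoint_infty hn hf.1 ha hW⟩
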